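/- Fix integers $\ell, L_y\ge 1$. For $L_x\ge \ell$ consider spinless fermions $a_{x,y}$ on the $L_x\times L_y$ square lattice, periodic in both directions, with Hamiltonian $H=H^X+H^Y$, $$H^X=-\tfrac12\sum_{x,y}\big(a^\dagger_{x+1,y}a_{x,y}+\mathrm{h.c.}\big),\qquad H^Y=-\tfrac12\sum_{x,y}\big(a^\dagger_{x,y+1}a_{x,y}+\mathrm{h.c.}\big).$$ Let $A$ be the strip of sites with $0\le x<\ell$ and $B$ its complement. For every $L_x$ let $|\psi_0\rangle=|\psi_0^{(L_x)}\rangle$ be a normalized state. Let $\lim_{L_x}$ denote either the thermodynamic limit $L_x\to\infty$ or evaluation at one fixed size $L_x$ (more generally, the limit along any fixed proper filter on the sizes $L_x\ge\ell$). Assume that for every $t\ge0$ the limits $$\rho_A(t)=\lim_{L_x}\mathrm{Tr}_B\, e^{-itH}|\psi_0\rangle\langle\psi_0|e^{itH},\qquad \rho_{X,A}(t)=\lim_{L_x}\mathrm{Tr}_B\, e^{-itH^X}|\psi_0\rangle\langle\psi_0|e^{itH^X}$$ exist; the first is the reduced state evolved with $H$, the second the one evolved with hopping in the $x$-direction only.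 For a finite family of commuting mode occupation operators $Q_k$ of the finite lattice, a generalized Gibbs ensemble (GGE) with charges $Q_k$ is a state of the form $e^{-\sum_k\lambda_kQ_k}/\mathrm{Tr}\,e^{-\sum_k\lambda_kQ_k}$ with real $\lambda_k$, or a limit of such states (so that $\lambda_k=\pm\infty$ is allowed), that satisfies $\mathrm{Tr}(Q_k\rho)=\langle\psi_0|Q_k|\psi_0\rangle$ for all $k$. * The GGE of $H$ has the charges $\tilde a_{\mathbf q}^\dagger\tilde a_{\mathbf q}$, with $\tilde a_{\mathbf q}=(L_xL_y)^{-1/2}\sum_{x,y}e^{-i(q_xx+q_yy)}a_{x,y}$, $q_x\in\frac{2\pi}{L_x}\{0,\dots,L_x-1\}$, $q_y\in\frac{2\pi}{L_y}\{0,\dots,L_y-1\}$. Write $\rho_A^{\mathrm{GGE}}=\lim_{L_x}\mathrm{Tr}_B\,\rho^{\mathrm{GGE}}$. * A GGE of $H^X$ has the charges $\alpha_{q_x,\mu}^\dagger\alpha_{q_x,\mu}$, with $\alpha_{q_x,\mu}=\sum_y[U(q_x)]_{\mu,y}\,d_{q_x,y}$ and $d_{q_x,y}=L_x^{-1/2}\sum_xe^{-iq_xx}a_{x,y}$,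 for some choice of $L_y\times L_y$ unitary matrices $U(q_x)$. Write $\rho_{X,A}^{\mathrm{GGE}}=\lim_{L_x}\mathrm{Tr}_B\,\rho_X^{\mathrm{GGE}}$. Assume: 1. $\rho_{X,A}(t)$ converges as $t\to\infty$, and its limit $\rho_{X,A}(\infty)$ is $\rho_{X,A}^{\mathrm{GGE}}$ for a GGE of $H^X$; 2. if $\lim_{t\to\infty}\rho_A(t)$ exists, then it equals $\rho_A^{\mathrm{GGE}}$ (in particular the latter limit over $L_x$ exists). Let $\mathcal T_A$ be the unitary translation by one site in the $y$-direction on the Fock space of $A$, so that $\mathcal T_Aa_{x,y}^\dagger\mathcal T_A^{-1}=a_{x,y+1}^\dagger$ and $\mathcal T_A|0\rangle=|0\rangle$. Then the following are equivalent: * $\lim_{t\to\infty}\rho_A(t)$ exists; * $\mathcal T_A\,\rho_{X,A}(\infty)\,\mathcal T_A^{-1}=\rho_{X,A}(\infty)$; * $\rho_{X,A}^{\mathrm{GGE}}=\rho_A^{\mathrm{GGE}}$, i.e. $\rho_A^{\mathrm{GGE}}$ exists and equals $\rho_{X,A}(\infty)$. -/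

import Mathlib

open Filter Topology Matrix

noncomputable section

namespace FermionQuench

/-- Sites `(x, y)` of an `Lx × Ly` lattice. The order is lexicographic: columns `x` are ordered
first, so the sites of the strip `x < ℓ` precede all the others. -/
abbrev Site (Lx Ly : ℕ) : Type := Fin Lx ×ₗ Fin Ly

/-- Operators on the fermionic Fock space of the `Lx × Ly` lattice, as matrices in the occupation
basis: a basis vector is a finite set `s = {i₁ < ⋯ < iₖ}` of occupied sites, and stands for
`a†_{i₁} ⋯ a†_{iₖ} |0⟩`. -/
abbrev Op (Lx Ly : ℕ) : Type := Matrix (Finset (Site Lx Ly)) (Finset (Site Lx Ly)) ℂ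

/-- Vectors of the Fock space, in the occupation basis. -/
abbrev FockVec (Lx Ly : ℕ) : Type := Finset (Site Lx Ly) → ℂ

section Fock

variable {Lx Ly : ℕ}

/-- The annihilation operator: `a_i |s⟩ = (-1)^{#{j ∈ s, j < i}} |s \ {i}⟩` if `i ∈ s`, and `0`
otherwise. -/
def ann (i : Site Lx Ly) : Op Lx Ly :=
  Matrix.of fun s' s =>
    if i ∈ s ∧ s' = s.erase i then (-1 : ℂ) ^ (s.filter (fun j => j < i)).card else 0

/-- The creation operator. -/
def cre (i : Site Lx Ly) : Op Lx Ly := (ann i)ᴴ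

/-- The vacuum. -/
def vac : FockVec Lx Ly := Pi.single ∅ 1

/-- The pure state `|ψ⟩⟨ψ|`. -/
def pureState (ψ : FockVec Lx Ly) : Op Lx Ly := Matrix.vecMulVec ψ (star ψ)

/-- `⟨ψ| O |ψ⟩`. -/
def expect (ψ : FockVec Lx Ly) (O : Op Lx Ly) : ℂ := star ψ ⬝ᵥ (O *ᵥ ψ)

/-- `e^{-i t H} |ψ⟩`. -/
def evolve (H : Op Lx Ly) (t : ℝ) (ψ : FockVec Lx Ly) : FockVec Lx Ly :=
  NormedSpace.exp ((-(Complex.I * (t : ℂ))) • H) *ᵥ ψ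

end Fock

/-! ### Hamiltonians, with periodic boundary conditions in both directions -/

/-- Hopping in the `x` direction. -/
def hamX (Lx Ly : ℕ) : Op Lx Ly :=
  -(1 / 2 : ℂ) • ∑ x : Fin Lx, ∑ y : Fin Ly,
    (cre (toLex (finRotate Lx x, y)) * ann (toLex (x, y)) +
      cre (toLex (x, y)) * ann (toLex (finRotate Lx x, y)))

/-- Hopping in the `y` direction. -/
def hamY (Lx Ly : ℕ) : Op Lx Ly :=
  -(1 / 2 : ℂ) • ∑ x : Fin Lx, ∑ y : Fin Ly,
    (cre (toLex (x, finRotate Ly y)) * ann (toLex (x, y)) +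
      cre (toLex (x, y)) * ann (toLex (x, finRotate Ly y)))

/-- The isotropic nearest-neighbour hopping Hamiltonian. -/
def ham (Lx Ly : ℕ) : Op Lx Ly := hamX Lx Ly + hamY Lx Ly

/-- The `y`-translation: it maps `a†_{i₁} ⋯ a†_{iₖ} |0⟩` to `a†_{τ i₁} ⋯ a†_{τ iₖ} |0⟩`, where
`τ (x, y) = (x, y + 1)`. -/
def transY (Lx Ly : ℕ) : Op Lx Ly :=
  Matrix.of fun s' s =>
    ((((s.sort (· ≤ ·)).map fun i : Site Lx Ly =>
      cre (toLex ((ofLex i).1, finRotate Ly (ofLex i).2))).prod) *ᵥ vac) s'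

/-! ### The strip `A = {x < ℓ}` in the lattice with `Lx = ℓ + M` columns -/

section Strip

variable {ℓ M Ly : ℕ}

/-- The configuration of the whole lattice with occupied sites `s` in `A` and `b` in the
complement `B`, which consists of the last `M` columns. -/
def joinConf (s : Finset (Site ℓ Ly)) (b : Finset (Site M Ly)) : Finset (Site (ℓ + M) Ly) :=
  s.image (fun i => toLex (Fin.castAdd M (ofLex i).1, (ofLex i).2)) ∪
    b.image (fun i => toLex (Fin.natAdd ℓ (ofLex i).1, (ofLex i).2))

/-- The partial trace over `B`. As the sites of `A` come first, `a_i` with `i ∈ A` is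
`a_i ⊗ 1` in the decomposition `|joinConf s b⟩ = |s⟩ ⊗ |b⟩`, so no further signs appear. -/
def traceB (ρ : Op (ℓ + M) Ly) : Op ℓ Ly :=
  Matrix.of fun s s' => ∑ b : Finset (Site M Ly), ρ (joinConf s b) (joinConf s' b)

end Strip

/-! ### Generalized Gibbs ensembles -/

section GGE

variable {Lx Ly : ℕ}

/-- `e^{-∑ₖ λₖ Qₖ} / Tr e^{-∑ₖ λₖ Qₖ}`. -/
def gibbs {κ : Type*} [Fintype κ] (Q : κ → Op Lx Ly) (lam : κ → ℝ) : Op Lx Ly :=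
  (Matrix.trace (NormedSpace.exp (-∑ k, (lam k : ℂ) • Q k)))⁻¹ •
    NormedSpace.exp (-∑ k, (lam k : ℂ) • Q k)

/-- `ρ` is the generalized Gibbs ensemble of the charges `Q` for the initial state `ψ`. The closure
allows the multipliers `λₖ = ±∞`, which are needed for a mode that is empty or full in `ψ`. -/
def IsGGE {κ : Type*} [Fintype κ] (Q : κ → Op Lx Ly) (ψ : FockVec Lx Ly) (ρ : Op Lx Ly) : Prop :=
  ρ ∈ closure (Set.range (gibbs Q)) ∧ ∀ k, Matrix.trace (Q k * ρ) = expect ψ (Q k)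

/-- `e^{-i q x}` for the quasi-momentum `q = 2 π k / L`. -/
def phase {L : ℕ} (k x : Fin L) : ℂ :=
  Complex.exp (-(Complex.I * (2 * Real.pi * (k : ℕ) * (x : ℕ) / (L : ℕ))))

/-- The Fourier mode `ã_q`, `q = (2 π k / Lx, 2 π l / Ly)`. -/
def momMode (q : Fin Lx × Fin Ly) : Op Lx Ly :=
  ((Real.sqrt ((Lx : ℝ) * (Ly : ℝ)) : ℂ))⁻¹ •
    ∑ x : Fin Lx, ∑ y : Fin Ly, (phase q.1 x * phase q.2 y) • ann (toLex (x, y))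

/-- The charges of `H`: the occupations `ã_q† ã_q`. -/
def charge (q : Fin Lx × Fin Ly) : Op Lx Ly := (momMode q)ᴴ * momMode q

/-- The partial Fourier mode `d_{q_x, y}`, `q_x = 2 π k / Lx`. -/
def xMode (k : Fin Lx) (y : Fin Ly) : Op Lx Ly :=
  ((Real.sqrt (Lx : ℝ) : ℂ))⁻¹ • ∑ x : Fin Lx, phase k x • ann (toLex (x, y))

/-- The modes `α_{q_x, μ} = ∑_y U(q_x)_{μ y} d_{q_x, y}`, `U(q_x)` unitary, which diagonalize the
Hamiltonian with hopping in the `x` direction only. -/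
def alphaMode (U : Fin Lx → Matrix.unitaryGroup (Fin Ly) ℂ) (p : Fin Lx × Fin Ly) : Op Lx Ly :=
  ∑ y : Fin Ly, (U p.1 : Matrix (Fin Ly) (Fin Ly) ℂ) p.2 y • xMode p.1 y

/-- The charges `α_{q_x, μ}† α_{q_x, μ}` of `H^X`. -/
def chargeX (U : Fin Lx → Matrix.unitaryGroup (Fin Ly) ℂ) (p : Fin Lx × Fin Ly) : Op Lx Ly :=
  (alphaMode U p)ᴴ * alphaMode U p

end GGE

section Limits

variable {ℓ Ly : ℕ}

/-- `ρ_A(t)` is, at every time, the limit over the system sizes `Lx = ℓ + M`, `M` along `𝓛`, of the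
reduced state on `A` of `e^{-i t H} |ψ⟩`, where `H` is the Hamiltonian for that size. -/
def IsReducedEvolution (𝓛 : Filter ℕ) (H : ∀ M : ℕ, Op (ℓ + M) Ly)
    (ψ : ∀ M : ℕ, FockVec (ℓ + M) Ly) (ρA : ℝ → Op ℓ Ly) : Prop :=
  ∀ t : ℝ, 0 ≤ t →
    Tendsto (fun M => traceB (pureState (evolve (H M) t (ψ M)))) 𝓛 (𝓝 (ρA t))

/-- `R` is `ρ_A^{GGE}`, the reduced GGE of `H`, in the limit `𝓛` of the system size. -/
def IsReducedGGE (𝓛 : Filter ℕ) (ψ : ∀ M : ℕ, FockVec (ℓ + M) Ly) (R : Op ℓ Ly) : Prop :=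
  ∃ ρ : ∀ M : ℕ, Op (ℓ + M) Ly,
    (∀ M, IsGGE charge (ψ M) (ρ M)) ∧ Tendsto (fun M => traceB (ρ M)) 𝓛 (𝓝 R)

/-- `R` is `ρ_{X,A}^{GGE}`, the reduced GGE of `H^X`, built from the charges
`α_{q_x, μ}† α_{q_x, μ}` for some choice of the unitaries `U(q_x)`, in the limit `𝓛` of the
system size. -/
def IsReducedGGEX (𝓛 : Filter ℕ) (ψ : ∀ M : ℕ, FockVec (ℓ + M) Ly) (R : Op ℓ Ly) : Prop :=
  ∃ (U : ∀ M : ℕ, Fin (ℓ + M) → Matrix.unitaryGroup (Fin Ly) ℂ) (ρ : ∀ M : ℕ, Op (ℓ + M) Ly),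
    (∀ M, IsGGE (chargeX (U M)) (ψ M) (ρ M)) ∧ Tendsto (fun M => traceB (ρ M)) 𝓛 (𝓝 R)

end Limits

end FermionQuench

end

/-! The hoppings in the two directions commute, and the hopping in `y` never leaves a column, so
`e^{-itH^Y}` is the product of a unitary `V(t)` of the strip (`evolY`) and a unitary of the
complement. Hence `ρ_A(t) = V(t) ρ_{X,A}(t) V(t)†` (`traceB_evolve_ham`, `reducedEvolution_ham_eq`),
and the question is what conjugation by `V(t)` does to the limit `R` of `ρ_{X,A}(t)`.

If `ρ_A(t)` tends to `R'`, so does `V(t) R V(t)†`. A time shift shows that every `V(s)` fixes `R'`,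
and undoing the conjugation gives `R = R'` (`limit_eq`), so that `R` is a reduced GGE of `H`. Such a
state is translation invariant because the Fourier-mode occupations are
(`IsReducedGGE.transY_conj`).

Conversely, translation invariance of a general state does not give invariance under `V(t)`. But `R`
inherits Gaussianity and number conservation from the GGE of `H^X`, so its correlation matrix
determines it (`IsGaussianWith.state_unique`). Invariance makes that matrix commute with the
one-particle shift, hence with the hopping and its propagator, so `V(t)` fixes `R`
(`evolY_conj_eq_of_transY_conj_eq`) and `ρ_A(t)` tends to `R`.

The many-body work is done by second quantization `Γ(m)` (`secQuant`): it is multiplicative, carries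
direct sums to tensor products, and has trace `det (1 + m)`. Gaussianity is the identity `tr (Γ(m)
ρ) = det (1 + (m - 1) C)` for all `m`. With `C` read off continuously from `ρ` this is a closed
condition, so it survives infinite multipliers and the limit over sizes. -/

noncomputable section

namespace FermionQuench

/-! ### Anticommutation relations and second quantization. -/

section FockAlgebra

variable {Lx Ly : ℕ}

/-- The Jordan–Wigner sign `(-1)^{#{j ∈ s, j < i}}`. -/
def jwSign (s : Finset (Site Lx Ly)) (i : Site Lx Ly) : ℂ :=
  (-1 : ℂ) ^ (s.filter (fun j => j < i)).card

lemma jwSign_mul_self (s : Finset (Site Lx Ly)) (i : Site Lx Ly) :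
    jwSign s i * jwSign s i = 1 := by
  rw [jwSign, ← pow_add, ← two_mul, pow_mul]; simp

lemma jwSign_insert {s : Finset (Site Lx Ly)} {i : Site Lx Ly} (hi : i ∉ s) (j : Site Lx Ly) :
    jwSign (insert i s) j = if i < j then -jwSign s j else jwSign s j := by
  unfold jwSign
  rw [Finset.filter_insert]
  split_ifs with h
  · rw [Finset.card_insert_of_notMem (by simp [hi]), pow_succ]; ring
  · rfl

lemma jwSign_erase {s : Finset (Site Lx Ly)} {i : Site Lx Ly} (hi : i ∈ s) (j : Site Lx Ly) :
    jwSign (s.erase i) j = if i < j then -jwSign s j else jwSign s j := by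
  have h := jwSign_insert (Finset.notMem_erase i s) j
  rw [Finset.insert_erase hi] at h
  rw [h]
  split_ifs <;> simp

lemma cre_apply (i : Site Lx Ly) (s s' : Finset (Site Lx Ly)) :
    cre i s s' = if i ∈ s ∧ s' = s.erase i then jwSign s i else 0 := by
  simp only [cre, ann, conjTranspose_apply, of_apply, jwSign]
  split_ifs <;> simp

lemma cre_mulVec (i : Site Lx Ly) (φ : FockVec Lx Ly) (s : Finset (Site Lx Ly)) :
    (cre i *ᵥ φ) s = if i ∈ s then jwSign s i * φ (s.erase i) else 0 := by
  simp only [mulVec, dotProduct, cre_apply]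
  split_ifs with h <;> simp [h]

lemma ann_mulVec (i : Site Lx Ly) (φ : FockVec Lx Ly) (s : Finset (Site Lx Ly)) :
    (ann i *ᵥ φ) s = if i ∈ s then 0 else jwSign s i * φ (insert i s) := by
  simp only [mulVec, dotProduct, ann, of_apply]
  split_ifs with h
  · refine Finset.sum_eq_zero fun x _ => ?_
    rw [if_neg, zero_mul]
    rintro ⟨_, rfl⟩
    simp at h
  · rw [Finset.sum_eq_single (insert i s)]
    · rw [if_pos (by simp [h])]
      congr 1
      have := jwSign_insert h i
      simpa [jwSign] using this
    · intro b _ hb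
      rw [if_neg, zero_mul]
      rintro ⟨h1, rfl⟩
      simp [Finset.insert_erase h1] at hb
    · simp

lemma op_ext {A B : Op Lx Ly} (h : ∀ φ s, (A *ᵥ φ) s = (B *ᵥ φ) s) : A = B :=
  Matrix.ext_of_mulVec_single fun _ => funext fun s => h _ s

lemma cre_mul_cre (i j : Site Lx Ly) : cre i * cre j = -(cre j * cre i) := by
  refine op_ext fun φ s => ?_
  simp only [neg_mulVec, ← mulVec_mulVec, cre_mulVec, Pi.neg_apply, Finset.mem_erase]
  by_cases hi : i ∈ s
  · by_cases hj : j ∈ s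
    · simp only [hi, hj, if_true, and_true, jwSign_erase]
      rcases lt_trichotomy i j with h | rfl | h
      · simp [h, h.ne, h.ne', h.not_gt, Finset.erase_right_comm (a := i)]; ring
      · simp
      · simp [h, h.ne, h.ne', h.not_gt, Finset.erase_right_comm (a := i)]; ring
    · simp [hj]
  · simp [hi]

lemma ann_mul_cre (i j : Site Lx Ly) :
    ann i * cre j = -(cre j * ann i) + (if i = j then 1 else 0) := by
  refine op_ext fun φ s => ?_
  simp only [add_mulVec, neg_mulVec, ← mulVec_mulVec, cre_mulVec, ann_mulVec, Pi.neg_apply,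
    Pi.add_apply, Finset.mem_erase, Finset.mem_insert]
  by_cases hij : i = j
  · subst hij
    by_cases hi : i ∈ s
    · simp [hi, jwSign_erase, ← mul_assoc, jwSign_mul_self]
    · simp [hi, jwSign_insert, ← mul_assoc, jwSign_mul_self]
  · have hji : j ≠ i := fun h => hij h.symm
    by_cases hi : i ∈ s
    · simp [hi, hij]
    · by_cases hj : j ∈ s
      · simp only [hi, hj, hij, hji, if_true, if_false, jwSign_erase, jwSign_insert,
          not_false_eq_true, or_true, and_false]
        rw [Finset.erase_insert_of_ne hij]
        rcases lt_or_gt_of_ne hij with h | h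
        · simp [h, h.not_gt]; ring
        · simp [h, h.not_gt]; ring
      · simp [hi, hj, hij, hji]

/-- The creation operator `∑ i, v i a†_i`. -/
def creV : (Site Lx Ly → ℂ) →ₗ[ℂ] Op Lx Ly where
  toFun v := ∑ i, v i • cre i
  map_add' v w := by simp [add_smul, Finset.sum_add_distrib]
  map_smul' c v := by simp [mul_smul, Finset.smul_sum]

lemma creV_eq (v : Site Lx Ly → ℂ) : creV v = ∑ i, v i • cre i := rfl

lemma creV_single (i : Site Lx Ly) : creV (Pi.single i 1) = cre i := by
  rw [creV_eq, Finset.sum_eq_single i] <;> simp +contextual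

lemma creV_mul_creV (v w : Site Lx Ly → ℂ) : creV v * creV w = -(creV w * creV v) := by
  simp only [creV_eq, Finset.sum_mul_sum, smul_mul_smul_comm]
  rw [Finset.sum_comm, ← Finset.sum_neg_distrib]
  refine Finset.sum_congr rfl fun i _ => ?_
  rw [← Finset.sum_neg_distrib]
  refine Finset.sum_congr rfl fun j _ => ?_
  rw [cre_mul_cre j i, mul_comm, smul_neg]

lemma op_eq_zero_of_eq_neg {A : Op Lx Ly} (h : A = -A) : A = 0 := by
  ext s s'
  exact self_eq_neg.mp (congrFun (congrFun h s) s')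

lemma creV_mul_self (v : Site Lx Ly → ℂ) : creV v * creV v = 0 :=
  op_eq_zero_of_eq_neg (creV_mul_creV v v)

/-- The second quantization `Γ(m)` of a one-particle operator `m`: it maps
`a†_{i₁} ⋯ a†_{iₖ} |0⟩` to `a†(m e_{i₁}) ⋯ a†(m e_{iₖ}) |0⟩`. -/
def secQuant (m : Matrix (Site Lx Ly) (Site Lx Ly) ℂ) : Op Lx Ly :=
  Matrix.of fun s' s =>
    ((((s.sort (· ≤ ·)).map fun i : Site Lx Ly => creV (m.col i)).prod) *ᵥ vac) s'

lemma secQuant_mulVec_single (m : Matrix (Site Lx Ly) (Site Lx Ly) ℂ)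
    (s : Finset (Site Lx Ly)) :
    secQuant m *ᵥ Pi.single s 1 =
      (((s.sort (· ≤ ·)).map fun i : Site Lx Ly => creV (m.col i)).prod) *ᵥ vac := by
  ext s'
  rw [mulVec_single_one]; rfl

lemma secQuant_vac (m : Matrix (Site Lx Ly) (Site Lx Ly) ℂ) : secQuant m *ᵥ vac = vac := by
  rw [vac, secQuant_mulVec_single, Finset.sort_empty, List.map_nil, List.prod_nil, one_mulVec, vac]

lemma sort_insert_eq_orderedInsert {s : Finset (Site Lx Ly)} {i : Site Lx Ly} (hi : i ∉ s) :
    (insert i s).sort (· ≤ ·) = (s.sort (· ≤ ·)).orderedInsert (· ≤ ·) i := by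
  refine List.Perm.eq_of_pairwise' (r := (· ≤ ·)) (Finset.pairwise_sort _ _)
    ((Finset.pairwise_sort s (· ≤ ·)).orderedInsert _ _) ?_
  refine .trans ?_ (List.perm_orderedInsert _ _ _).symm
  rw [← Multiset.coe_eq_coe, ← Multiset.cons_coe]
  simp [hi]

/-- In a sorted list the entries below `i` form an initial segment; `c i` moves past exactly these,
with one sign each. -/
lemma prod_map_orderedInsert {R : Type*} [Ring R] (c : Site Lx Ly → R)
    (hc : ∀ i j, c i * c j = -(c j * c i)) (i : Site Lx Ly) (l : List (Site Lx Ly))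
    (hl : l.Pairwise (· ≤ ·)) :
    c i * (l.map c).prod =
      (-1) ^ (l.filter (fun j => j < i)).length * ((l.orderedInsert (· ≤ ·) i).map c).prod := by
  induction l with
  | nil => simp
  | cons j l ih =>
    have hl' := List.pairwise_cons.mp hl
    by_cases h : i ≤ j
    · have h0 : (j :: l).filter (fun k => k < i) = [] := by
        rw [List.filter_eq_nil_iff]
        intro k hk
        rcases List.mem_cons.mp hk with rfl | hk
        · simpa using h
        · simpa using h.trans (hl'.1 k hk)
      simp [h0, List.orderedInsert, h]
    · simp only [List.map_cons, List.prod_cons, List.orderedInsert, h, if_false]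
      rw [← mul_assoc, hc, neg_mul, mul_assoc, ih hl'.2, List.filter_cons_of_pos (by simpa using h),
        List.length_cons, pow_succ, ← mul_assoc, ← mul_assoc]
      rw [((Commute.neg_one_right (c j)).pow_right _).eq]
      simp

lemma prod_map_eq_zero_of_mem {R : Type*} [Ring R] (c : Site Lx Ly → R)
    (hc : ∀ i j, c i * c j = -(c j * c i)) (hc0 : ∀ i, c i * c i = 0) (i : Site Lx Ly)
    (l : List (Site Lx Ly)) (hi : i ∈ l) : c i * (l.map c).prod = 0 := by
  induction l with
  | nil => simp at hi
  | cons j l ih =>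
    simp only [List.map_cons, List.prod_cons]
    rcases List.mem_cons.mp hi with rfl | h
    · rw [← mul_assoc, hc0, zero_mul]
    · rw [← mul_assoc, hc, neg_mul, mul_assoc, ih h, mul_zero, neg_zero]

lemma length_filter_sort (s : Finset (Site Lx Ly)) (i : Site Lx Ly) :
    ((s.sort (· ≤ ·)).filter (fun j => j < i)).length = (s.filter (fun j => j < i)).card := by
  rw [← Finset.length_sort (· ≤ ·) (s := s.filter _), ← Multiset.coe_card, ← Multiset.coe_card,
    Finset.sort_eq, Finset.filter_val, ← Multiset.filter_coe, Finset.sort_eq]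

/-- Stated for any anticommuting square-zero family, so that `cre` and the columns `creV (m.col i)`
obey one rule with the same signs. This is why `Γ(m)` intertwines them. -/
lemma mul_prod_map_sort (c : Site Lx Ly → Op Lx Ly)
    (hc : ∀ i j, c i * c j = -(c j * c i)) (hc0 : ∀ i, c i * c i = 0) (i : Site Lx Ly)
    (s : Finset (Site Lx Ly)) :
    c i * ((s.sort (· ≤ ·)).map c).prod =
      if i ∈ s then 0 else jwSign s i • (((insert i s).sort (· ≤ ·)).map c).prod := by
  split_ifs with h
  · exact prod_map_eq_zero_of_mem c hc hc0 i _ (by simpa using h)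
  · rw [prod_map_orderedInsert c hc i _ (Finset.pairwise_sort _ _),
      sort_insert_eq_orderedInsert h, length_filter_sort, jwSign]
    rcases Nat.even_or_odd (s.filter (fun j => j < i)).card with he | he <;>
      simp [he.neg_one_pow]

lemma cre_mulVec_single (i : Site Lx Ly) (s : Finset (Site Lx Ly)) :
    cre i *ᵥ (Pi.single s 1 : FockVec Lx Ly) =
      if i ∈ s then 0 else jwSign s i • Pi.single (insert i s) 1 := by
  ext s'
  rw [mulVec_single_one, col_apply, cre_apply]
  split_ifs with h1 h2 h2
  · simp [h1.2] at h2
  · obtain ⟨h1, rfl⟩ := h1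
    simp [Finset.insert_erase h1, jwSign_erase h1]
  · rfl
  · rw [Pi.smul_apply, Pi.single_eq_of_ne, smul_zero]
    rintro rfl
    simp [h2] at h1

lemma secQuant_mul_cre (m : Matrix (Site Lx Ly) (Site Lx Ly) ℂ) (i : Site Lx Ly) :
    secQuant m * cre i = creV (m.col i) * secQuant m := by
  refine Matrix.ext_of_mulVec_single fun s => ?_
  rw [← mulVec_mulVec, ← mulVec_mulVec, cre_mulVec_single, secQuant_mulVec_single, mulVec_mulVec,
    mul_prod_map_sort (fun i => creV (m.col i)) (fun _ _ => creV_mul_creV _ _)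
      (fun _ => creV_mul_self _)]
  split_ifs with h
  · simp
  · rw [mulVec_smul, secQuant_mulVec_single, smul_mulVec]

lemma secQuant_mul_creV (m : Matrix (Site Lx Ly) (Site Lx Ly) ℂ) (v : Site Lx Ly → ℂ) :
    secQuant m * creV v = creV (m *ᵥ v) * secQuant m := by
  have h : m *ᵥ v = ∑ i, v i • m.col i := by
    ext j; simp [mulVec, dotProduct, mul_comm]
  rw [h, map_sum, Finset.sum_mul, creV_eq, Finset.mul_sum]
  refine Finset.sum_congr rfl fun i _ => ?_
  rw [mul_smul_comm, secQuant_mul_cre, map_smul, smul_mul_assoc]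

lemma prod_map_cre_vac (s : Finset (Site Lx Ly)) :
    ((s.sort (· ≤ ·)).map cre).prod *ᵥ vac = (Pi.single s 1 : FockVec Lx Ly) := by
  induction s using Finset.induction_on with
  | empty => rw [Finset.sort_empty, List.map_nil, List.prod_nil, one_mulVec, vac]
  | insert i s hi ih =>
    have h := mul_prod_map_sort (cre (Lx := Lx) (Ly := Ly)) cre_mul_cre
      (fun i => op_eq_zero_of_eq_neg (cre_mul_cre i i)) i s
    rw [if_neg hi] at h
    have h2 := cre_mulVec_single i s
    rw [← ih, mulVec_mulVec, h, if_neg hi, smul_mulVec] at h2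
    have h3 := congrArg (fun v => jwSign s i • v) h2
    simpa only [smul_smul, jwSign_mul_self, one_smul] using h3

/-- An operator that fixes the vacuum and intertwines the creation operators like `Γ(m)` is
`Γ(m)`. -/
lemma eq_secQuant {m : Matrix (Site Lx Ly) (Site Lx Ly) ℂ} {G : Op Lx Ly}
    (h0 : G *ᵥ vac = vac) (h : ∀ i, G * cre i = creV (m.col i) * G) : G = secQuant m := by
  refine Matrix.ext_of_mulVec_single fun s => ?_
  rw [secQuant_mulVec_single, ← prod_map_cre_vac, mulVec_mulVec]
  -- Every basis vector is a product of creation operators applied to the vacuum, so moving `G`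
  -- through the product determines it.
  have key : ∀ l : List (Site Lx Ly),
      G * (l.map cre).prod = (l.map fun i => creV (m.col i)).prod * G := by
    intro l
    induction l with
    | nil => simp
    | cons i l ih =>
      simp only [List.map_cons, List.prod_cons]
      rw [← mul_assoc, h, mul_assoc, ih, mul_assoc]
  rw [key, ← mulVec_mulVec, h0]

lemma secQuant_one : secQuant (1 : Matrix (Site Lx Ly) (Site Lx Ly) ℂ) = 1 := by
  refine (eq_secQuant (by simp) fun i => ?_).symm
  have : (1 : Matrix (Site Lx Ly) (Site Lx Ly) ℂ).col i = Pi.single i 1 := by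
    ext j; simp [one_apply, Pi.single_apply]
  rw [this, creV_single]; simp

/-- The product fixes the vacuum and intertwines like `Γ(m * n)`, so uniqueness applies. -/
lemma secQuant_mul (m n : Matrix (Site Lx Ly) (Site Lx Ly) ℂ) :
    secQuant (m * n) = secQuant m * secQuant n := by
  refine (eq_secQuant ?_ fun i => ?_).symm
  · rw [← mulVec_mulVec, secQuant_vac, secQuant_vac]
  · rw [mul_assoc, secQuant_mul_cre, ← mul_assoc, secQuant_mul_creV, mul_assoc]
    rfl

end FockAlgebra

/-! ### Matrix elements, adjoint and trace of `Γ(m)`. -/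

section Minors

variable {Lx Ly : ℕ}

lemma jwSign_orderEmbOfFin {s : Finset (Site Lx Ly)} {k : ℕ} (h : s.card = k) (a : Fin k) :
    jwSign s (s.orderEmbOfFin h a) = (-1) ^ (a : ℕ) := by
  have : s.filter (fun j => j < s.orderEmbOfFin h a) =
      (Finset.univ.filter fun b : Fin k => b < a).map (s.orderEmbOfFin h).toEmbedding := by
    ext j
    simp only [Finset.mem_filter, Finset.mem_map, Finset.mem_univ, true_and,
      RelEmbedding.coe_toEmbedding]
    constructor
    · rintro ⟨hj, hlt⟩
      have : j ∈ Set.range (s.orderEmbOfFin h) := by simpa using hj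
      obtain ⟨b, rfl⟩ := this
      exact ⟨b, (s.orderEmbOfFin h).lt_iff_lt.mp hlt, rfl⟩
    · rintro ⟨b, hb, rfl⟩
      exact ⟨Finset.orderEmbOfFin_mem _ _ _, (s.orderEmbOfFin h).lt_iff_lt.mpr hb⟩
  rw [jwSign, this, Finset.card_map]
  congr 1
  have h2 : (Finset.univ.filter fun b : Fin k => b < a) = Finset.Iio a := by ext; simp
  rw [h2, Fin.card_Iio]

lemma creV_mulVec (v : Site Lx Ly → ℂ) (φ : FockVec Lx Ly) (s : Finset (Site Lx Ly)) :
    (creV v *ᵥ φ) s = ∑ i ∈ s, v i * (jwSign s i * φ (s.erase i)) := by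
  rw [creV_eq, sum_mulVec, Finset.sum_apply, ← Finset.sum_subset (Finset.subset_univ s)]
  · refine Finset.sum_congr rfl fun i hi => ?_
    rw [smul_mulVec, Pi.smul_apply, cre_mulVec, if_pos hi, smul_eq_mul]
  · intro i _ hi
    rw [smul_mulVec, Pi.smul_apply, cre_mulVec, if_neg hi, smul_zero]

lemma prod_ofFn_creV_vac (k : ℕ) (v : Fin k → Site Lx Ly → ℂ) (s : Finset (Site Lx Ly)) :
    ((List.ofFn fun b => creV (v b)).prod *ᵥ vac) s =
      if h : s.card = k then
        det (Matrix.of fun a b : Fin k => v b (s.orderEmbOfFin h a)) else 0 := by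
  induction k generalizing s with
  | zero =>
    rw [List.ofFn_zero, List.prod_nil, one_mulVec, vac]
    by_cases h : s = ∅
    · subst h; simp
    · rw [Pi.single_eq_of_ne h, dif_neg (by simpa using h)]
  | succ k ih =>
    rw [List.ofFn_succ, List.prod_cons, ← mulVec_mulVec, creV_mulVec]
    split_ifs with h
    · have hsum : ∀ f : Site Lx Ly → ℂ,
          ∑ i ∈ s, f i = ∑ a : Fin (k + 1), f (s.orderEmbOfFin h a) := by
        intro f
        conv_lhs => rw [← Finset.map_orderEmbOfFin_univ s h]
        rw [Finset.sum_map]; rfl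
      -- Laplace expansion along the first column: the Jordan–Wigner sign of the `a`-th occupied
      -- site is the cofactor sign `(-1) ^ a`.
      rw [hsum, det_succ_column_zero]
      refine Finset.sum_congr rfl fun a _ => ?_
      have hc : (s.erase (s.orderEmbOfFin h a)).card = k := by
        rw [Finset.card_erase_of_mem (Finset.orderEmbOfFin_mem _ _ _), h]; rfl
      have he : s.orderEmbOfFin h ∘ a.succAbove =
          (s.erase (s.orderEmbOfFin h a)).orderEmbOfFin hc := by
        refine Finset.orderEmbOfFin_unique hc (fun x => ?_)
          ((s.orderEmbOfFin h).strictMono.comp (Fin.strictMono_succAbove a))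
        simp only [Function.comp, Finset.mem_erase, Finset.orderEmbOfFin_mem, and_true]
        simp [Fin.succAbove_ne]
      rw [ih, dif_pos hc, jwSign_orderEmbOfFin, ← mul_assoc, mul_comm (v 0 _)]
      congr 2
      ext b c
      exact congrArg (v c.succ) (congrFun he b).symm
    · refine Finset.sum_eq_zero fun i hi => ?_
      rw [ih, dif_neg, mul_zero, mul_zero]
      rw [Finset.card_erase_of_mem hi]
      have := Finset.card_pos.mpr ⟨i, hi⟩
      omega

lemma secQuant_eq_ofFn (m : Matrix (Site Lx Ly) (Site Lx Ly) ℂ) (s' s : Finset (Site Lx Ly))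
    {k : ℕ} (h : s.card = k) :
    secQuant m s' s =
      ((List.ofFn fun b : Fin k => creV (m.col (s.orderEmbOfFin h b))).prod *ᵥ vac) s' := by
  rw [secQuant, of_apply, ← Finset.listMap_orderEmbOfFin_finRange s h, List.map_map,
    List.ofFn_eq_map]
  rfl

/-- The matrix elements of `Γ(m)` are the minors of `m`. -/
lemma secQuant_apply (m : Matrix (Site Lx Ly) (Site Lx Ly) ℂ) (s' s : Finset (Site Lx Ly))
    {k : ℕ} (h' : s'.card = k) (h : s.card = k) :
    secQuant m s' s = det (m.submatrix (s'.orderEmbOfFin h') (s.orderEmbOfFin h)) := by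
  rw [secQuant_eq_ofFn m s' s h, prod_ofFn_creV_vac, dif_pos h']
  rfl

lemma secQuant_apply_of_card_ne (m : Matrix (Site Lx Ly) (Site Lx Ly) ℂ)
    {s' s : Finset (Site Lx Ly)} (h : s'.card ≠ s.card) : secQuant m s' s = 0 := by
  rw [secQuant_eq_ofFn m s' s rfl, prod_ofFn_creV_vac, dif_neg h]

lemma secQuant_conjTranspose (m : Matrix (Site Lx Ly) (Site Lx Ly) ℂ) :
    (secQuant m)ᴴ = secQuant mᴴ := by
  ext s' s
  rw [conjTranspose_apply]
  by_cases h : s'.card = s.card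
  · rw [secQuant_apply m s s' rfl h, secQuant_apply mᴴ s' s h rfl, ← conjTranspose_submatrix,
      det_conjTranspose]
  · rw [secQuant_apply_of_card_ne _ h, secQuant_apply_of_card_ne _ (Ne.symm h), star_zero]

/-- The trace is the sum of all principal minors. Multilinearity of `det (m + 1)` in the rows gives
the same sum: the term of `s` takes the rows in `s` from `m` and the others from `1`. -/
lemma trace_secQuant (m : Matrix (Site Lx Ly) (Site Lx Ly) ℂ) :
    trace (secQuant m) = det (1 + m) := by
  have h : ∀ s : Finset (Site Lx Ly),
      secQuant m s s = det (Matrix.of <| s.piecewise m.row (1 : Matrix _ _ ℂ).row) := by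
    intro s
    rw [det_piecewise_one_eq_submatrix_det, secQuant_apply m s s rfl rfl,
      ← det_submatrix_equiv_self (s.orderIsoOfFin rfl).toEquiv]
    rfl
  rw [trace, add_comm]
  exact (Finset.sum_congr rfl fun s _ => h s).trans
    (detRowAlternating.map_add_univ m.row (1 : Matrix _ _ ℂ).row).symm

end Minors

/-! ### Exponentials of quadratic operators. -/

section Exp

variable {Lx Ly : ℕ}

/-- The quadratic operator `∑ i j, h i j a†_i a_j` with one-particle operator `h`. -/
def quadOp (h : Matrix (Site Lx Ly) (Site Lx Ly) ℂ) : Op Lx Ly :=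
  ∑ i, ∑ j, h i j • (cre i * ann j)

lemma quadOp_add (h h' : Matrix (Site Lx Ly) (Site Lx Ly) ℂ) :
    quadOp (h + h') = quadOp h + quadOp h' := by
  simp [quadOp, add_smul, Finset.sum_add_distrib]

lemma quadOp_smul (c : ℂ) (h : Matrix (Site Lx Ly) (Site Lx Ly) ℂ) :
    quadOp (c • h) = c • quadOp h := by
  simp [quadOp, mul_smul, Finset.smul_sum]

lemma quadOp_sum {κ : Type*} (t : Finset κ) (h : κ → Matrix (Site Lx Ly) (Site Lx Ly) ℂ) :
    quadOp (∑ k ∈ t, h k) = ∑ k ∈ t, quadOp (h k) := by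
  classical
  induction t using Finset.induction_on with
  | empty => simp [quadOp]
  | insert k t hk ih => rw [Finset.sum_insert hk, quadOp_add, ih, Finset.sum_insert hk]

lemma quadOp_vac (h : Matrix (Site Lx Ly) (Site Lx Ly) ℂ) : quadOp h *ᵥ vac = 0 := by
  have h0 : ∀ j : Site Lx Ly, ann j *ᵥ vac = 0 := by
    intro j; ext s
    rw [ann_mulVec, vac, Pi.single_eq_of_ne (Finset.insert_ne_empty _ _)]
    simp
  simp [quadOp, sum_mulVec, smul_mulVec, ← mulVec_mulVec, h0]

/-- Two anticommutations restore the sign and leave one contraction. This commutator is the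
infinitesimal form of the intertwining by `Γ`. -/
lemma quadOp_mul_cre (h : Matrix (Site Lx Ly) (Site Lx Ly) ℂ) (l : Site Lx Ly) :
    quadOp h * cre l = cre l * quadOp h + creV (h.col l) := by
  have key : ∀ i j : Site Lx Ly, cre i * ann j * cre l =
      cre l * (cre i * ann j) + if j = l then cre i else 0 := by
    intro i j
    rw [mul_assoc, ann_mul_cre, mul_add, mul_neg, ← mul_assoc, cre_mul_cre i l, ← mul_assoc]
    split_ifs <;> simp
  simp only [quadOp, Finset.sum_mul, smul_mul_assoc, key, smul_add, Finset.sum_add_distrib,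
    Finset.mul_sum, mul_smul_comm, creV_eq, col_apply]
  congr 1
  refine Finset.sum_congr rfl fun i _ => ?_
  rw [Finset.sum_eq_single l] <;> simp +contextual

lemma quadOp_mul_creV (h : Matrix (Site Lx Ly) (Site Lx Ly) ℂ) (v : Site Lx Ly → ℂ) :
    quadOp h * creV v = creV v * quadOp h + creV (h *ᵥ v) := by
  have h1 : h *ᵥ v = ∑ i, v i • h.col i := by
    ext j; simp [mulVec, dotProduct, mul_comm]
  rw [h1, map_sum, creV_eq, Finset.mul_sum, Finset.sum_mul, ← Finset.sum_add_distrib]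
  refine Finset.sum_congr rfl fun i _ => ?_
  rw [mul_smul_comm, quadOp_mul_cre, map_smul, smul_mul_assoc, smul_add]

-- The derivative of `exp (u • quadOp h) *ᵥ vac` in `u` vanishes, since `quadOp h` kills the vacuum.
open NormedSpace in
attribute [local instance] Matrix.linftyOpNormedRing Matrix.linftyOpNormedAlgebra in
lemma exp_quadOp_vac (h : Matrix (Site Lx Ly) (Site Lx Ly) ℂ) :
    exp (quadOp h) *ᵥ vac = vac := by
  let ev : Op Lx Ly →L[ℂ] FockVec Lx Ly :=
    LinearMap.toContinuousLinearMap ((Matrix.mulVecBilin ℂ ℂ).flip vac)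
  have hev : ∀ A : Op Lx Ly, ev A = A *ᵥ vac := fun A => rfl
  have hd : ∀ t : ℂ, HasDerivAt (fun u : ℂ => ev (exp (u • quadOp h))) 0 t := by
    intro t
    have h1 := ev.hasFDerivAt.comp_hasDerivAt t (hasDerivAt_exp_smul_const (quadOp h) t)
    refine h1.congr_deriv ?_
    change (exp (t • quadOp h) * quadOp h) *ᵥ vac = 0
    rw [← mulVec_mulVec, quadOp_vac, mulVec_zero]
  have := is_const_of_deriv_eq_zero (fun t => (hd t).differentiableAt) (fun t => (hd t).deriv) 1 0
  simpa [hev] using this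

-- The curve `exp (-u Q) a†(exp (u h) v) exp (u Q)`, with `Q = quadOp h`, has zero derivative by the
-- commutator formula; its values at `u = 1` and `u = 0` are compared.
open NormedSpace in
attribute [local instance] Matrix.linftyOpNormedRing Matrix.linftyOpNormedAlgebra in
lemma exp_quadOp_mul_creV (h : Matrix (Site Lx Ly) (Site Lx Ly) ℂ) (v : Site Lx Ly → ℂ) :
    exp (quadOp h) * creV v = creV (exp h *ᵥ v) * exp (quadOp h) := by
  let cv : Matrix (Site Lx Ly) (Site Lx Ly) ℂ →L[ℂ] Op Lx Ly :=
    LinearMap.toContinuousLinearMap (creV ∘ₗ (Matrix.mulVecBilin ℂ ℂ).flip v)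
  have hcv : ∀ A, cv A = creV (A *ᵥ v) := fun A => rfl
  have hd : ∀ t : ℂ, HasDerivAt
      (fun u : ℂ => exp (u • -quadOp h) * cv (exp (u • h)) * exp (u • quadOp h)) 0 t := by
    intro t
    have h1 := hasDerivAt_exp_smul_const (-quadOp h) t
    have h2 := cv.hasFDerivAt.comp_hasDerivAt t (hasDerivAt_exp_smul_const' h t)
    have h3 := hasDerivAt_exp_smul_const' (quadOp h) t
    refine ((h1.mul h2).mul h3).congr_deriv ?_
    change (exp (t • -quadOp h) * -quadOp h * creV (exp (t • h) *ᵥ v) +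
      exp (t • -quadOp h) * creV ((h * exp (t • h)) *ᵥ v)) * exp (t • quadOp h) +
      exp (t • -quadOp h) * creV (exp (t • h) *ᵥ v) * (quadOp h * exp (t • quadOp h)) = 0
    rw [← mulVec_mulVec]
    have h4 := quadOp_mul_creV h (exp (t • h) *ᵥ v)
    have h5 : creV (h *ᵥ (exp (t • h) *ᵥ v)) =
      quadOp h * creV (exp (t • h) *ᵥ v) - creV (exp (t • h) *ᵥ v) * quadOp h := by
      rw [h4]; abel
    rw [h5]
    noncomm_ring
  have h01 := is_const_of_deriv_eq_zero (fun t => (hd t).differentiableAt)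
    (fun t => (hd t).deriv) 1 0
  simp only [one_smul, zero_smul, exp_zero, hcv, one_mulVec, one_mul, mul_one] at h01
  rw [← h01, ← mul_assoc, ← mul_assoc, ← Matrix.exp_add_of_commute _ _ (Commute.refl (quadOp h)).neg_right]
  simp

/-- `exp` of a quadratic operator is the second quantization of `exp` of its one-particle
operator. -/
lemma exp_quadOp (h : Matrix (Site Lx Ly) (Site Lx Ly) ℂ) :
    NormedSpace.exp (quadOp h) = secQuant (NormedSpace.exp h) := by
  refine eq_secQuant (exp_quadOp_vac h) fun i => ?_
  rw [← creV_single, exp_quadOp_mul_creV, mulVec_single_one]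

end Exp

/-! ### Tensor factorization along the strip and its complement. -/

section Bipartition

variable {ℓ M Ly : ℕ}

/-- The inclusion of the strip `A` into the lattice. -/
def inA (M : ℕ) (i : Site ℓ Ly) : Site (ℓ + M) Ly :=
  toLex (Fin.castAdd M (ofLex i).1, (ofLex i).2)

/-- The inclusion of the complement `B` of the strip into the lattice. -/
def inB (ℓ : ℕ) (i : Site M Ly) : Site (ℓ + M) Ly :=
  toLex (Fin.natAdd ℓ (ofLex i).1, (ofLex i).2)

/-- The sites of the lattice are those of `A` and those of `B`. -/
def siteEquiv (ℓ M Ly : ℕ) : Site ℓ Ly ⊕ Site M Ly ≃ Site (ℓ + M) Ly :=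
  ((Equiv.sumCongr ofLex ofLex).trans (Equiv.sumProdDistrib _ _ _).symm).trans
    ((finSumFinEquiv.prodCongr (Equiv.refl _)).trans toLex)

@[simp] lemma siteEquiv_inl (i : Site ℓ Ly) : siteEquiv ℓ M Ly (Sum.inl i) = inA M i := rfl

@[simp] lemma siteEquiv_inr (i : Site M Ly) : siteEquiv ℓ M Ly (Sum.inr i) = inB ℓ i := rfl

@[simp] lemma inA_inj {i j : Site ℓ Ly} : inA M i = inA M j ↔ i = j := by
  rw [← siteEquiv_inl, ← siteEquiv_inl, (siteEquiv ℓ M Ly).apply_eq_iff_eq, Sum.inl.injEq]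

@[simp] lemma inB_inj {i j : Site M Ly} : inB ℓ i = inB ℓ j ↔ i = j := by
  rw [← siteEquiv_inr, ← siteEquiv_inr, (siteEquiv ℓ M Ly).apply_eq_iff_eq, Sum.inr.injEq]

@[simp] lemma inA_ne_inB (i : Site ℓ Ly) (j : Site M Ly) : inA M i ≠ inB ℓ j := by
  rw [← siteEquiv_inl, ← siteEquiv_inr, Ne, (siteEquiv ℓ M Ly).apply_eq_iff_eq]
  exact Sum.inl_ne_inr

@[simp] lemma inB_ne_inA (i : Site ℓ Ly) (j : Site M Ly) : inB ℓ j ≠ inA M i :=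
  (inA_ne_inB i j).symm

@[simp] lemma inA_lt_inA {i j : Site ℓ Ly} : inA M i < inA M j ↔ i < j := by
  simp [inA, Prod.Lex.lt_iff, (Fin.strictMono_castAdd M).lt_iff_lt]

@[simp] lemma inB_lt_inB {i j : Site M Ly} : inB ℓ i < inB ℓ j ↔ i < j := by
  simp [inB, Prod.Lex.lt_iff]

@[simp] lemma inA_lt_inB (i : Site ℓ Ly) (j : Site M Ly) : inA M i < inB ℓ j := by
  simp only [inA, inB, Prod.Lex.lt_iff]
  left
  simp only [Fin.lt_def, ofLex_toLex, Fin.val_castAdd, Fin.val_natAdd]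
  omega

lemma forall_site {p : Site (ℓ + M) Ly → Prop} :
    (∀ i, p i) ↔ (∀ i, p (inA M i)) ∧ ∀ j, p (inB ℓ j) := by
  rw [← (siteEquiv ℓ M Ly).forall_congr_right, Sum.forall]; simp

lemma joinConf_eq (s : Finset (Site ℓ Ly)) (b : Finset (Site M Ly)) :
    joinConf s b = s.image (inA M) ∪ b.image (inB ℓ) := rfl

@[simp] lemma inA_mem_joinConf {s : Finset (Site ℓ Ly)} {b : Finset (Site M Ly)} {i} :
    inA M i ∈ joinConf s b ↔ i ∈ s := by
  simp [joinConf_eq]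

@[simp] lemma inB_mem_joinConf {s : Finset (Site ℓ Ly)} {b : Finset (Site M Ly)} {i} :
    inB ℓ i ∈ joinConf s b ↔ i ∈ b := by
  simp [joinConf_eq]

lemma card_joinConf (s : Finset (Site ℓ Ly)) (b : Finset (Site M Ly)) :
    (joinConf s b).card = s.card + b.card := by
  rw [joinConf_eq, Finset.card_union_of_disjoint,
    Finset.card_image_of_injective _ fun i j => inA_inj.mp,
    Finset.card_image_of_injective _ fun i j => inB_inj.mp]
  simp only [Finset.disjoint_left, Finset.mem_image, not_exists, not_and]
  rintro _ ⟨i, _, rfl⟩ j _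
  exact inB_ne_inA i j

/-- Configurations of the lattice are pairs of configurations of `A` and `B`. -/
def confEquiv (ℓ M Ly : ℕ) :
    Finset (Site ℓ Ly) × Finset (Site M Ly) ≃ Finset (Site (ℓ + M) Ly) where
  toFun p := joinConf p.1 p.2
  invFun t := (Finset.univ.filter fun i => inA M i ∈ t, Finset.univ.filter fun i => inB ℓ i ∈ t)
  left_inv p := by ext <;> simp
  right_inv t := by
    rw [Finset.ext_iff, forall_site]; simp

@[simp] lemma confEquiv_apply (p : Finset (Site ℓ Ly) × Finset (Site M Ly)) :
    confEquiv ℓ M Ly p = joinConf p.1 p.2 := rfl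

@[simp] lemma confEquiv_symm_joinConf (s : Finset (Site ℓ Ly)) (b : Finset (Site M Ly)) :
    (confEquiv ℓ M Ly).symm (joinConf s b) = (s, b) :=
  (confEquiv ℓ M Ly).symm_apply_apply (s, b)

@[simp] lemma joinConf_inj {s s' : Finset (Site ℓ Ly)} {b b' : Finset (Site M Ly)} :
    joinConf s b = joinConf s' b' ↔ s = s' ∧ b = b' := by
  rw [← confEquiv_apply (s, b), ← confEquiv_apply (s', b'), (confEquiv ℓ M Ly).apply_eq_iff_eq,
    Prod.mk.injEq]

lemma forall_conf {p : Finset (Site (ℓ + M) Ly) → Prop} :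
    (∀ t, p t) ↔ ∀ s b, p (joinConf s b) := by
  rw [← (confEquiv ℓ M Ly).forall_congr_right, Prod.forall]; rfl

lemma sum_conf {R : Type*} [AddCommMonoid R] (f : Finset (Site (ℓ + M) Ly) → R) :
    ∑ t, f t = ∑ s, ∑ b, f (joinConf s b) := by
  rw [← (confEquiv ℓ M Ly).sum_comp, Fintype.sum_prod_type]; rfl

lemma joinConf_erase_inA (s : Finset (Site ℓ Ly)) (b : Finset (Site M Ly)) (i) :
    (joinConf s b).erase (inA M i) = joinConf (s.erase i) b := by
  rw [Finset.ext_iff, forall_site]; simp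

lemma joinConf_erase_inB (s : Finset (Site ℓ Ly)) (b : Finset (Site M Ly)) (i) :
    (joinConf s b).erase (inB ℓ i) = joinConf s (b.erase i) := by
  rw [Finset.ext_iff, forall_site]; simp

lemma jwSign_joinConf_inA (s : Finset (Site ℓ Ly)) (b : Finset (Site M Ly)) (i) :
    jwSign (joinConf s b) (inA M i) = jwSign s i := by
  have : (joinConf s b).filter (fun j => j < inA M i) =
      joinConf (s.filter fun j => j < i) ∅ := by
    rw [Finset.ext_iff, forall_site]
    simp [fun j => (inA_lt_inB i (M := M) j).not_gt]
  rw [jwSign, this, card_joinConf]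
  simp [jwSign]

/-- All sites of `A` precede those of `B`, so the whole of `s` contributes. Creation operators on
`B` therefore carry the parity of `A`. -/
lemma jwSign_joinConf_inB (s : Finset (Site ℓ Ly)) (b : Finset (Site M Ly)) (i) :
    jwSign (joinConf s b) (inB ℓ i) = (-1) ^ s.card * jwSign b i := by
  have : (joinConf s b).filter (fun j => j < inB ℓ i) =
      joinConf s (b.filter fun j => j < i) := by
    rw [Finset.ext_iff, forall_site]; simp
  rw [jwSign, this, card_joinConf, pow_add, jwSign]

/-- The operator `X ⊗ Y` in the decomposition `|joinConf s b⟩ = |s⟩ ⊗ |b⟩`. -/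
def opProd (X : Op ℓ Ly) (Y : Op M Ly) : Op (ℓ + M) Ly :=
  (kroneckerMap (· * ·) X Y).submatrix (confEquiv ℓ M Ly).symm (confEquiv ℓ M Ly).symm

@[simp] lemma opProd_apply (X : Op ℓ Ly) (Y : Op M Ly) (s s' b b') :
    opProd X Y (joinConf s b) (joinConf s' b') = X s s' * Y b b' := by
  simp [opProd]

lemma op_ext_joinConf {X Y : Op (ℓ + M) Ly}
    (h : ∀ s b s' b', X (joinConf s b) (joinConf s' b') = Y (joinConf s b) (joinConf s' b')) :
    X = Y := by
  ext t t'
  revert t'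
  rw [forall_conf]
  intro s' b'
  revert t
  rw [forall_conf]
  exact fun s b => h s b s' b'

lemma opProd_mul (X X' : Op ℓ Ly) (Y Y' : Op M Ly) :
    opProd X Y * opProd X' Y' = opProd (X * X') (Y * Y') := by
  rw [opProd, opProd, submatrix_mul_equiv, ← mul_kronecker_mul]; rfl

lemma opProd_sum_left {κ : Type*} (t : Finset κ) (X : κ → Op ℓ Ly) (Y : Op M Ly) :
    opProd (∑ k ∈ t, X k) Y = ∑ k ∈ t, opProd (X k) Y := by
  refine op_ext_joinConf fun s b s' b' => ?_
  simp [Matrix.sum_apply, Finset.sum_mul]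

lemma opProd_sum_right {κ : Type*} (t : Finset κ) (X : Op ℓ Ly) (Y : κ → Op M Ly) :
    opProd X (∑ k ∈ t, Y k) = ∑ k ∈ t, opProd X (Y k) := by
  refine op_ext_joinConf fun s b s' b' => ?_
  simp [Matrix.sum_apply, Finset.mul_sum]

lemma opProd_smul_left (c : ℂ) (X : Op ℓ Ly) (Y : Op M Ly) :
    opProd (c • X) Y = c • opProd X Y := by
  refine op_ext_joinConf fun s b s' b' => ?_
  simp [mul_assoc]

lemma opProd_smul_right (c : ℂ) (X : Op ℓ Ly) (Y : Op M Ly) :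
    opProd X (c • Y) = c • opProd X Y := by
  refine op_ext_joinConf fun s b s' b' => ?_
  simp [mul_left_comm]

lemma opProd_mulVec_vac {X : Op ℓ Ly} {Y : Op M Ly} (hX : X *ᵥ vac = vac) (hY : Y *ᵥ vac = vac) :
    opProd X Y *ᵥ vac = vac := by
  have h0 : (∅ : Finset (Site (ℓ + M) Ly)) = joinConf ∅ ∅ := by simp [joinConf_eq]
  rw [vac, mulVec_single_one] at hX hY ⊢
  rw [funext_iff, forall_conf]
  intro s b
  have hXs := congrFun hX s
  have hYb := congrFun hY b
  rw [col_apply] at hXs hYb ⊢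
  rw [h0, opProd_apply, hXs, hYb]
  by_cases hs : s = ∅ <;> by_cases hb : b = ∅ <;> simp [hs, hb]

/-- The fermion parity `(-1)^N` is `Γ(-1)`. -/
lemma secQuant_neg_one : secQuant (-1 : Matrix (Site ℓ Ly) (Site ℓ Ly) ℂ) =
    diagonal fun s => (-1 : ℂ) ^ s.card := by
  refine (eq_secQuant ?_ fun i => ?_).symm
  · ext s
    rw [mulVec_diagonal, vac]
    by_cases h : s = ∅
    · simp [h]
    · simp [h]
  · have h1 : (-1 : Matrix (Site ℓ Ly) (Site ℓ Ly) ℂ).col i = -Pi.single i 1 := by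
      ext j; simp [one_apply, Pi.single_apply]
    rw [h1, map_neg, creV_single]
    ext s s'
    rw [diagonal_mul, mul_diagonal, neg_apply, cre_apply]
    split_ifs with h
    · obtain ⟨h, rfl⟩ := h
      have := Finset.card_erase_add_one h
      rw [← this, pow_succ]; ring
    · simp

lemma cre_inA (i : Site ℓ Ly) : cre (inA M i) = opProd (cre i) 1 := by
  refine op_ext_joinConf fun s b s' b' => ?_
  rw [opProd_apply, cre_apply, cre_apply, joinConf_erase_inA, jwSign_joinConf_inA, one_apply]
  simp only [inA_mem_joinConf, joinConf_inj]
  by_cases h : b = b'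
  · simp [h]
  · simp [h, Ne.symm h]

lemma cre_inB (i : Site M Ly) :
    cre (inB ℓ i) = opProd (secQuant (-1 : Matrix (Site ℓ Ly) (Site ℓ Ly) ℂ)) (cre i) := by
  refine op_ext_joinConf fun s b s' b' => ?_
  rw [opProd_apply, cre_apply, cre_apply, joinConf_erase_inB, jwSign_joinConf_inB,
    secQuant_neg_one, diagonal_apply]
  simp only [inB_mem_joinConf, joinConf_inj]
  by_cases h : s = s'
  · simp [h]
  · simp [h, Ne.symm h]

/-- The one-particle operator `mA ⊕ mB`. -/
def directSum (mA : Matrix (Site ℓ Ly) (Site ℓ Ly) ℂ) (mB : Matrix (Site M Ly) (Site M Ly) ℂ) :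
    Matrix (Site (ℓ + M) Ly) (Site (ℓ + M) Ly) ℂ :=
  (fromBlocks mA 0 0 mB).submatrix (siteEquiv ℓ M Ly).symm (siteEquiv ℓ M Ly).symm

@[simp] lemma siteEquiv_symm_inA (i : Site ℓ Ly) :
    (siteEquiv ℓ M Ly).symm (inA M i) = Sum.inl i := by
  rw [← siteEquiv_inl, Equiv.symm_apply_apply]

@[simp] lemma siteEquiv_symm_inB (i : Site M Ly) :
    (siteEquiv ℓ M Ly).symm (inB ℓ i) = Sum.inr i := by
  rw [← siteEquiv_inr, Equiv.symm_apply_apply]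

lemma sum_site {R : Type*} [AddCommMonoid R] (f : Site (ℓ + M) Ly → R) :
    ∑ t, f t = ∑ i, f (inA M i) + ∑ j, f (inB ℓ j) := by
  rw [← (siteEquiv ℓ M Ly).sum_comp, Fintype.sum_sum_type]; simp

/-- `Γ(mA ⊕ mB) = Γ(mA) ⊗ Γ(mB)`. -/
lemma secQuant_directSum (mA : Matrix (Site ℓ Ly) (Site ℓ Ly) ℂ)
    (mB : Matrix (Site M Ly) (Site M Ly) ℂ) :
    secQuant (directSum mA mB) = opProd (secQuant mA) (secQuant mB) := by
  refine (eq_secQuant (opProd_mulVec_vac (secQuant_vac _) (secQuant_vac _)) ?_).symm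
  rw [forall_site]
  constructor
  · intro i
    have h : creV ((directSum mA mB).col (inA M i)) = opProd (creV (mA.col i)) 1 := by
      rw [creV_eq, sum_site, creV_eq, opProd_sum_left]
      simp [directSum, cre_inA, opProd_smul_left]
    rw [h, cre_inA, opProd_mul, opProd_mul, secQuant_mul_cre, one_mul, mul_one]
  · intro i
    have h : creV ((directSum mA mB).col (inB ℓ i)) = opProd (secQuant (-1)) (creV (mB.col i)) := by
      rw [creV_eq, sum_site, creV_eq, opProd_sum_right]
      simp [directSum, cre_inB, opProd_smul_right]
    -- The parity `Γ(-1)` commutes with `Γ(mA)`, because `-1` commutes with `mA`.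
    rw [h, cre_inB, opProd_mul, opProd_mul, secQuant_mul_cre, ← secQuant_mul, ← secQuant_mul]
    simp

lemma trace_mul_traceB (X : Op ℓ Ly) (ρ : Op (ℓ + M) Ly) :
    trace (X * traceB ρ) = trace (opProd X 1 * ρ) := by
  simp only [trace, diag_apply, mul_apply, sum_conf, opProd_apply, traceB, of_apply,
    Finset.mul_sum, one_apply]
  refine Finset.sum_congr rfl fun s _ => ?_
  rw [Finset.sum_comm]
  refine Finset.sum_congr rfl fun b _ => ?_
  refine Finset.sum_congr rfl fun s' _ => ?_
  rw [Finset.sum_eq_single b] <;> simp +contextual [eq_comm]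

/-- The partial trace is cyclic for operators on `B`, so only the product `Y' * Y` enters. -/
lemma traceB_opProd_mul_mul (X X' : Op ℓ Ly) {Y Y' : Op M Ly} (hY : Y' * Y = 1)
    (ρ : Op (ℓ + M) Ly) :
    traceB (opProd X Y * ρ * opProd X' Y') = X * traceB ρ * X' := by
  ext s s'
  simp only [mul_apply, sum_conf, opProd_apply, traceB, of_apply, Finset.sum_mul, Finset.mul_sum]
  have hY' : ∀ c' c, ∑ b, Y b c * Y' c' b = if c' = c then 1 else 0 := by
    intro c' c
    rw [← one_apply, ← hY, mul_apply]
    exact Finset.sum_congr rfl fun b _ => mul_comm _ _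
  calc _ = ∑ r', ∑ r, ∑ c', ∑ c, (X s r * ρ (joinConf r c) (joinConf r' c') * X' r' s') *
          ∑ b, Y b c * Y' c' b := by
        simp only [Finset.mul_sum]
        rw [Finset.sum_comm]
        refine Finset.sum_congr rfl fun r' _ => ?_
        rw [Finset.sum_comm]
        symm
        rw [Finset.sum_comm]
        refine Finset.sum_congr rfl fun c' _ => ?_
        symm
        rw [Finset.sum_comm]
        refine Finset.sum_congr rfl fun r _ => ?_
        rw [Finset.sum_comm]
        refine Finset.sum_congr rfl fun c _ => ?_
        refine Finset.sum_congr rfl fun b _ => ?_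
        ring
    _ = _ := by
        refine Finset.sum_congr rfl fun r' _ => ?_
        refine Finset.sum_congr rfl fun r _ => ?_
        refine Finset.sum_congr rfl fun c' _ => ?_
        simp [hY']

end Bipartition

/-! ### One-particle shifts, hopping and propagators. -/

section Translations

variable {ι : Type*} [DecidableEq ι]

/-- The matrix of `e_i ↦ e_{σ i}`. -/
def permOp (σ : Equiv.Perm ι) : Matrix ι ι ℂ := (1 : Matrix ι ι ℂ).submatrix id σ

lemma permOp_apply (σ : Equiv.Perm ι) (i j : ι) : permOp σ i j = if i = σ j then 1 else 0 := by
  simp [permOp, one_apply]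

lemma permOp_one : permOp (1 : Equiv.Perm ι) = 1 := rfl

lemma permOp_conjTranspose (σ : Equiv.Perm ι) : (permOp σ)ᴴ = permOp σ⁻¹ := by
  ext i j
  simp only [conjTranspose_apply, permOp_apply, Equiv.Perm.eq_inv_iff_eq, eq_comm]
  split_ifs <;> simp

/-- The one-particle operator `-(σ + σ⁻¹) / 2` of hopping along `σ`. -/
def hop (σ : Equiv.Perm ι) : Matrix ι ι ℂ := -(1 / 2 : ℂ) • (permOp σ + permOp σ⁻¹)

lemma hop_isHermitian (σ : Equiv.Perm ι) : (hop σ).IsHermitian := by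
  rw [IsHermitian, hop, conjTranspose_smul, conjTranspose_add, permOp_conjTranspose,
    permOp_conjTranspose, inv_inv, add_comm]
  simp

variable [Fintype ι]

lemma permOp_mul_apply (σ : Equiv.Perm ι) (A : Matrix ι ι ℂ) (i j : ι) :
    (permOp σ * A) (σ i) j = A i j := by
  simp [mul_apply, permOp_apply]

lemma mul_permOp_apply (σ : Equiv.Perm ι) (A : Matrix ι ι ℂ) (i j : ι) :
    (A * permOp σ) i j = A i (σ j) := by
  simp [mul_apply, permOp_apply]

lemma permOp_mul (σ τ : Equiv.Perm ι) : permOp σ * permOp τ = permOp (σ * τ) := by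
  ext i j
  rw [mul_permOp_apply, permOp_apply, permOp_apply]
  rfl

lemma permOp_mul_inv (σ : Equiv.Perm ι) : permOp σ * permOp σ⁻¹ = 1 := by
  rw [permOp_mul, mul_inv_cancel, permOp_one]

lemma permOp_inv_mul (σ : Equiv.Perm ι) : permOp σ⁻¹ * permOp σ = 1 := by
  rw [permOp_mul, inv_mul_cancel, permOp_one]

lemma commute_permOp {σ : Equiv.Perm ι} {A : Matrix ι ι ℂ}
    (h : ∀ i j, A (σ i) (σ j) = A i j) : Commute (permOp σ) A := by
  refine Matrix.ext fun i j => ?_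
  obtain ⟨i, rfl⟩ := σ.surjective i
  rw [permOp_mul_apply, mul_permOp_apply, h]

/-- What commutes with an invertible matrix commutes with its inverse. -/
lemma Commute.hop_right {σ : Equiv.Perm ι} {A : Matrix ι ι ℂ} (h : Commute A (permOp σ)) :
    Commute A (hop σ) := by
  refine Commute.smul_right (h.add_right ?_) _
  calc A * permOp σ⁻¹ = permOp σ⁻¹ * (permOp σ * A) * permOp σ⁻¹ := by
        rw [← mul_assoc, permOp_inv_mul, one_mul]
    _ = permOp σ⁻¹ * A := by
        rw [← h.eq, mul_assoc, mul_assoc, permOp_mul_inv, mul_one]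

/-- The one-particle propagator `e^{-i t h}`. -/
def propagator (h : Matrix ι ι ℂ) (t : ℝ) : Matrix ι ι ℂ :=
  NormedSpace.exp ((-(Complex.I * (t : ℂ))) • h)

lemma propagator_conjTranspose {h : Matrix ι ι ℂ} (hh : h.IsHermitian) (t : ℝ) :
    (propagator h t)ᴴ = propagator h (-t) := by
  rw [propagator, propagator, ← Matrix.exp_conjTranspose, conjTranspose_smul, hh.eq]
  simp

lemma propagator_add (h : Matrix ι ι ℂ) (s t : ℝ) :
    propagator h (s + t) = propagator h s * propagator h t := by
  rw [propagator, propagator, propagator, ← Matrix.exp_add_of_commute, ← add_smul]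
  · push_cast; ring_nf
  · exact ((Commute.refl h).smul_left _).smul_right _

lemma propagator_zero (h : Matrix ι ι ℂ) : propagator h 0 = 1 := by
  simp [propagator]

end Translations

/-! ### The Hamiltonians and the translation in second-quantized form. -/

section Hamiltonians

variable {Lx Ly : ℕ}

/-- Translation of sites by one in the `x` direction. -/
def shiftX (Lx Ly : ℕ) : Equiv.Perm (Site Lx Ly) :=
  (ofLex.trans ((finRotate Lx).prodCongr (Equiv.refl _))).trans toLex

/-- Translation of sites by one in the `y` direction. -/
def shiftY (Lx Ly : ℕ) : Equiv.Perm (Site Lx Ly) :=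
  (ofLex.trans ((Equiv.refl _).prodCongr (finRotate Ly))).trans toLex

lemma shiftY_apply (i : Site Lx Ly) :
    shiftY Lx Ly i = toLex ((ofLex i).1, finRotate Ly (ofLex i).2) := rfl

lemma shiftX_mul_shiftY : shiftX Lx Ly * shiftY Lx Ly = shiftY Lx Ly * shiftX Lx Ly := rfl

lemma creV_permOp_col (σ : Equiv.Perm (Site Lx Ly)) (i : Site Lx Ly) :
    creV ((permOp σ).col i) = cre (σ i) := by
  have : (permOp σ).col i = Pi.single (σ i) 1 := by
    ext j; simp [permOp_apply, Pi.single_apply]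
  rw [this, creV_single]

lemma transY_eq_secQuant : transY Lx Ly = secQuant (permOp (shiftY Lx Ly)) := by
  simp only [transY, secQuant, creV_permOp_col]
  rfl

lemma transY_inv_eq_secQuant : (transY Lx Ly)⁻¹ = secQuant (permOp (shiftY Lx Ly)⁻¹) := by
  refine inv_eq_right_inv ?_
  rw [transY_eq_secQuant, ← secQuant_mul, permOp_mul_inv, secQuant_one]

lemma quadOp_permOp (σ : Equiv.Perm (Site Lx Ly)) :
    quadOp (permOp σ) = ∑ j, cre (σ j) * ann j := by
  rw [quadOp, Finset.sum_comm]
  refine Finset.sum_congr rfl fun j _ => ?_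
  simp [permOp_apply]

lemma quadOp_hop (σ : Equiv.Perm (Site Lx Ly)) :
    quadOp (hop σ) = -(1 / 2 : ℂ) • ∑ j, (cre (σ j) * ann j + cre j * ann (σ j)) := by
  rw [hop, quadOp_smul, quadOp_add, quadOp_permOp, quadOp_permOp, Finset.sum_add_distrib]
  congr 2
  rw [← Equiv.sum_comp σ]
  simp

lemma sum_site_prod {R : Type*} [AddCommMonoid R] (f : Site Lx Ly → R) :
    ∑ i, f i = ∑ x : Fin Lx, ∑ y : Fin Ly, f (toLex (x, y)) := by
  rw [← toLex.sum_comp f, Fintype.sum_prod_type]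

lemma hamX_eq_quadOp : hamX Lx Ly = quadOp (hop (shiftX Lx Ly)) := by
  rw [quadOp_hop, hamX, sum_site_prod]; rfl

lemma hamY_eq_quadOp : hamY Lx Ly = quadOp (hop (shiftY Lx Ly)) := by
  rw [quadOp_hop, hamY, sum_site_prod]; rfl

/-- The second-quantized propagator of the hopping in the `y` direction. -/
def evolY (Lx Ly : ℕ) (t : ℝ) : Op Lx Ly := secQuant (propagator (hop (shiftY Lx Ly)) t)

lemma evolY_conjTranspose (t : ℝ) : (evolY Lx Ly t)ᴴ = evolY Lx Ly (-t) := by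
  rw [evolY, secQuant_conjTranspose, propagator_conjTranspose (hop_isHermitian _), evolY]

lemma evolY_add (s t : ℝ) : evolY Lx Ly (s + t) = evolY Lx Ly s * evolY Lx Ly t := by
  rw [evolY, propagator_add, secQuant_mul, evolY, evolY]

lemma evolY_zero : evolY Lx Ly 0 = 1 := by
  rw [evolY, propagator_zero, secQuant_one]

lemma evolY_conjTranspose_mul_self (t : ℝ) : (evolY Lx Ly t)ᴴ * evolY Lx Ly t = 1 := by
  rw [evolY_conjTranspose, ← evolY_add, neg_add_cancel, evolY_zero]

lemma evolY_mul_conjTranspose_self (t : ℝ) : evolY Lx Ly t * (evolY Lx Ly t)ᴴ = 1 := by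
  rw [evolY_conjTranspose, ← evolY_add, add_neg_cancel, evolY_zero]

/-- The two shifts commute, hence so do the one-particle hoppings, and the propagator factors before
second quantization. -/
lemma evolve_ham (t : ℝ) (ψ : FockVec Lx Ly) :
    evolve (ham Lx Ly) t ψ = evolY Lx Ly t *ᵥ evolve (hamX Lx Ly) t ψ := by
  have hc : Commute (hop (shiftY Lx Ly)) (hop (shiftX Lx Ly)) := by
    refine Commute.hop_right (Commute.hop_right ?_).symm
    rw [Commute, SemiconjBy, permOp_mul, permOp_mul, shiftX_mul_shiftY]
  rw [evolve, evolve, mulVec_mulVec, ham, add_comm, hamX_eq_quadOp, hamY_eq_quadOp, ← quadOp_add,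
    ← quadOp_smul, ← quadOp_smul, exp_quadOp, exp_quadOp, smul_add, Matrix.exp_add_of_commute,
    secQuant_mul]
  · rfl
  · exact (hc.smul_left _).smul_right _

lemma pureState_mulVec (A : Op Lx Ly) (ψ : FockVec Lx Ly) :
    pureState (A *ᵥ ψ) = A * pureState ψ * Aᴴ := by
  rw [pureState, pureState, star_mulVec, mul_vecMulVec, vecMulVec_mul]

end Hamiltonians

/-! ### Factorization of the `y` evolution over strip and complement. -/

section StripDynamics

variable {ℓ M Ly : ℕ}

/-- `(mA, mB) ↦ mA ⊕ mB` as a ring homomorphism. -/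
def directSumHom (ℓ M Ly : ℕ) :
    Matrix (Site ℓ Ly) (Site ℓ Ly) ℂ × Matrix (Site M Ly) (Site M Ly) ℂ →+*
      Matrix (Site (ℓ + M) Ly) (Site (ℓ + M) Ly) ℂ where
  toFun p := directSum p.1 p.2
  map_one' := by simp [directSum]
  map_mul' p q := by
    simp only [directSum, submatrix_mul_equiv, fromBlocks_multiply]
    simp
  map_zero' := by simp [directSum]
  map_add' p q := by
    change (fromBlocks (p.1 + q.1) 0 0 (p.2 + q.2)).submatrix _ _ =
      (fromBlocks p.1 0 0 p.2 + fromBlocks q.1 0 0 q.2).submatrix _ _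
    rw [fromBlocks_add, add_zero, add_zero]

-- The block-diagonal embedding is a continuous ring homomorphism, and such maps commute with `exp`.
attribute [local instance] Matrix.linftyOpNormedRing Matrix.linftyOpNormedAlgebra in
lemma exp_directSum (mA : Matrix (Site ℓ Ly) (Site ℓ Ly) ℂ)
    (mB : Matrix (Site M Ly) (Site M Ly) ℂ) :
    NormedSpace.exp (directSum mA mB) =
      directSum (NormedSpace.exp mA) (NormedSpace.exp mB) := by
  have hc : Continuous (directSumHom ℓ M Ly) := by
    change Continuous fun p : Matrix (Site ℓ Ly) (Site ℓ Ly) ℂ × Matrix (Site M Ly) (Site M Ly) ℂ =>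
      (fromBlocks p.1 0 0 p.2).submatrix (siteEquiv ℓ M Ly).symm (siteEquiv ℓ M Ly).symm
    exact (continuous_fst.matrix_fromBlocks continuous_const continuous_const
      continuous_snd).matrix_submatrix _ _
  let : NormedAlgebra ℚ (Matrix (Site ℓ Ly) (Site ℓ Ly) ℂ) := NormedAlgebra.restrictScalars ℚ ℂ _
  let : NormedAlgebra ℚ (Matrix (Site M Ly) (Site M Ly) ℂ) := NormedAlgebra.restrictScalars ℚ ℂ _
  have h := NormedSpace.map_exp (directSumHom ℓ M Ly) hc (mA, mB)
  refine h.symm.trans ?_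
  exact congrArg₂ directSum (Prod.fst_exp (mA, mB)) (Prod.snd_exp (mA, mB))

lemma directSum_smul (c : ℂ) (mA : Matrix (Site ℓ Ly) (Site ℓ Ly) ℂ)
    (mB : Matrix (Site M Ly) (Site M Ly) ℂ) :
    directSum (c • mA) (c • mB) = c • directSum mA mB := by
  change _ = (c • fromBlocks mA 0 0 mB).submatrix _ _
  rw [directSum, fromBlocks_smul, smul_zero, smul_zero]

lemma directSum_add (mA mA' : Matrix (Site ℓ Ly) (Site ℓ Ly) ℂ)
    (mB mB' : Matrix (Site M Ly) (Site M Ly) ℂ) :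
    directSum (mA + mA') (mB + mB') = directSum mA mB + directSum mA' mB' :=
  (directSumHom ℓ M Ly).map_add (mA, mB) (mA', mB')

lemma directSum_permOp {σA : Equiv.Perm (Site ℓ Ly)} {σB : Equiv.Perm (Site M Ly)}
    {σ : Equiv.Perm (Site (ℓ + M) Ly)} (hA : ∀ i, σ (inA M i) = inA M (σA i))
    (hB : ∀ i, σ (inB ℓ i) = inB ℓ (σB i)) :
    permOp σ = directSum (permOp σA) (permOp σB) := by
  refine Matrix.ext fun i j => ?_
  obtain ⟨i, rfl⟩ := (siteEquiv ℓ M Ly).surjective i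
  obtain ⟨j, rfl⟩ := (siteEquiv ℓ M Ly).surjective j
  rcases i with i | i <;> rcases j with j | j <;> simp [directSum, permOp_apply, hA, hB]

lemma permOp_shiftY_eq_directSum :
    permOp (shiftY (ℓ + M) Ly) = directSum (permOp (shiftY ℓ Ly)) (permOp (shiftY M Ly)) :=
  directSum_permOp (fun _ => rfl) (fun _ => rfl)

lemma permOp_shiftY_inv_eq_directSum :
    permOp (shiftY (ℓ + M) Ly)⁻¹ =
      directSum (permOp (shiftY ℓ Ly)⁻¹) (permOp (shiftY M Ly)⁻¹) := by
  refine directSum_permOp (fun i => ?_) (fun i => ?_) <;> rw [Equiv.Perm.inv_eq_iff_eq]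
  · exact congrArg (inA M) ((shiftY ℓ Ly).apply_symm_apply i).symm
  · exact congrArg (inB ℓ) ((shiftY M Ly).apply_symm_apply i).symm

lemma evolY_eq_opProd (t : ℝ) :
    evolY (ℓ + M) Ly t = opProd (evolY ℓ Ly t) (evolY M Ly t) := by
  rw [evolY, evolY, evolY, ← secQuant_directSum, propagator, propagator, propagator,
    ← exp_directSum, directSum_smul, hop, hop, hop, directSum_smul, directSum_add,
    permOp_shiftY_eq_directSum, permOp_shiftY_inv_eq_directSum]

/-- The hopping in the `y` direction acts on the reduced state by conjugation with a unitary
of the strip. -/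
lemma traceB_evolve_ham (t : ℝ) (ψ : FockVec (ℓ + M) Ly) :
    traceB (pureState (evolve (ham (ℓ + M) Ly) t ψ)) =
      evolY ℓ Ly t * traceB (pureState (evolve (hamX (ℓ + M) Ly) t ψ)) * (evolY ℓ Ly t)ᴴ := by
  rw [evolve_ham, pureState_mulVec, evolY_conjTranspose, evolY_eq_opProd, evolY_eq_opProd,
    traceB_opProd_mul_mul, evolY_conjTranspose]
  rw [← evolY_add, neg_add_cancel, evolY_zero]

end StripDynamics

/-! ### Conjugation by varying unitaries. -/

section Conjugation

variable {n α : Type*} [Fintype n] [DecidableEq n]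

-- The operator norm is unitarily invariant, so the unitaries themselves need not converge.
open scoped Matrix.Norms.L2Operator in
lemma tendsto_conj_zero {F : Filter α} {U X : α → Matrix n n ℂ} (h1 : ∀ a, (U a)ᴴ * U a = 1)
    (h2 : ∀ a, U a * (U a)ᴴ = 1) (hX : Tendsto X F (𝓝 0)) :
    Tendsto (fun a => U a * X a * (U a)ᴴ) F (𝓝 0) := by
  rw [tendsto_zero_iff_norm_tendsto_zero] at hX ⊢
  convert hX using 2 with a
  have hU : U a ∈ unitary (Matrix n n ℂ) := Unitary.mem_iff.mpr ⟨h1 a, h2 a⟩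
  have hU' : (U a)ᴴ ∈ unitary (Matrix n n ℂ) := Unitary.star_mem hU
  rw [CStarRing.norm_mul_mem_unitary _ hU', CStarRing.norm_mem_unitary_mul _ hU]

end Conjugation

/-! ### Gaussian states and their correlation matrices. -/

section Gaussian

variable {Lx Ly : ℕ}

/-- A Gaussian state with correlation matrix `C`, given by its generating function. -/
def IsGaussianWith (C : Matrix (Site Lx Ly) (Site Lx Ly) ℂ) (ρ : Op Lx Ly) : Prop :=
  ∀ m, trace (secQuant m * ρ) = det (1 + (m - 1) * C)

/-- The correlation matrix read off from the generating function. -/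
def corrMatrix (ρ : Op Lx Ly) : Matrix (Site Lx Ly) (Site Lx Ly) ℂ :=
  Matrix.of fun j i => trace (secQuant (1 + single i j 1) * ρ) - 1

/-- A rank-one perturbation of the identity. Testing with `m = 1 + single i j 1` thus extracts one
entry of `C`. -/
lemma det_one_add_single_mul {ι : Type*} [Fintype ι] [DecidableEq ι] (i j : ι)
    (C : Matrix ι ι ℂ) : det (1 + single i j 1 * C) = 1 + C j i := by
  have : single i j (1 : ℂ) * C = replicateCol Unit (Pi.single i (1 : ℂ)) * replicateRow Unit (C j) := by
    ext a b
    rw [mul_apply, mul_apply]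
    by_cases h : a = i
    · subst h; simp [single_apply]
    · simp [h, Ne.symm h]
  rw [this, det_one_add_replicateCol_mul_replicateRow]
  simp

lemma IsGaussianWith.corrMatrix_eq {C : Matrix (Site Lx Ly) (Site Lx Ly) ℂ} {ρ : Op Lx Ly}
    (h : IsGaussianWith C ρ) : corrMatrix ρ = C := by
  ext j i
  rw [corrMatrix, of_apply, h, add_sub_cancel_left, det_one_add_single_mul]
  ring

lemma IsGaussianWith.unique {C C' : Matrix (Site Lx Ly) (Site Lx Ly) ℂ} {ρ : Op Lx Ly}
    (h : IsGaussianWith C ρ) (h' : IsGaussianWith C' ρ) : C = C' :=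
  h.corrMatrix_eq.symm.trans h'.corrMatrix_eq

/-- Using `corrMatrix ρ` in place of an existential `C` makes both sides continuous in `ρ`. -/
lemma isClosed_gaussian : IsClosed {ρ : Op Lx Ly | IsGaussianWith (corrMatrix ρ) ρ} := by
  have htr : ∀ m, Continuous fun ρ : Op Lx Ly => trace (secQuant m * ρ) := fun m =>
    (continuous_const.matrix_mul continuous_id).matrix_trace
  simp only [IsGaussianWith, Set.ofPred_forall]
  refine isClosed_iInter fun m => isClosed_eq (htr m) ?_
  refine (continuous_const.add (continuous_const.matrix_mul ?_)).matrix_det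
  exact continuous_matrix fun j i => (htr _).sub continuous_const

/-- Conjugation by `Γ(u)` conjugates the correlation matrix by `u`. -/
lemma IsGaussianWith.conj {C : Matrix (Site Lx Ly) (Site Lx Ly) ℂ} {ρ : Op Lx Ly}
    (h : IsGaussianWith C ρ) {u u' : Matrix (Site Lx Ly) (Site Lx Ly) ℂ} (hu : u' * u = 1) :
    IsGaussianWith (u * C * u') (secQuant u * ρ * secQuant u') := by
  intro m
  rw [← mul_assoc, trace_mul_comm, ← mul_assoc, ← mul_assoc, ← secQuant_mul, ← secQuant_mul, h]
  -- Since `u' * u = 1`, the difference `u' * m * u - 1` is `u' * (m - 1) * u`; then `det (1 + XY) =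
  -- det (1 + YX)`.
  have h1 : (1 : Matrix (Site Lx Ly) (Site Lx Ly) ℂ) + (u' * m * u - 1) * C =
      1 + u' * ((m - 1) * (u * C)) := by
    have h2 : 1 + (u' * m * u - u' * u) * C = 1 + u' * ((m - 1) * (u * C)) := by noncomm_ring
    rwa [hu] at h2
  rw [h1, det_one_add_mul_comm]
  congr 2
  noncomm_ring

/-- Testing the reduced state with `Γ(m)` is testing `ρ` with `Γ(m ⊕ 1)`. The rows of `m ⊕ 1 - 1` in
`B` vanish, so the determinant is block triangular and only the `A` block of `C` contributes. -/
lemma IsGaussianWith.traceB {ℓ M : ℕ} {C : Matrix (Site (ℓ + M) Ly) (Site (ℓ + M) Ly) ℂ}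
    {ρ : Op (ℓ + M) Ly} (h : IsGaussianWith C ρ) :
    IsGaussianWith (C.submatrix (inA M) (inA M)) (traceB ρ : Op ℓ Ly) := by
  intro m
  have h1 : opProd (secQuant m) 1 = secQuant (directSum m (1 : Matrix (Site M Ly) _ ℂ)) := by
    rw [secQuant_directSum, secQuant_one]
  rw [trace_mul_traceB, h1, h, ← det_submatrix_equiv_self (siteEquiv ℓ M Ly)]
  have h2 : (1 + (directSum m (1 : Matrix (Site M Ly) _ ℂ) - 1) * C).submatrix
        (siteEquiv ℓ M Ly) (siteEquiv ℓ M Ly) =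
      fromBlocks (1 + (m - 1) * C.submatrix (inA M) (inA M))
        ((m - 1) * C.submatrix (inA M) (inB ℓ)) 0 1 := by
    have h3 : ∀ i j, (directSum m (1 : Matrix (Site M Ly) _ ℂ) - 1) (inA M i) (inA M j) =
        (m - 1) i j := by
      intro i j; simp [directSum, one_apply]
    have h4 : ∀ i j, (directSum m (1 : Matrix (Site M Ly) _ ℂ) - 1) (inA M i) (inB ℓ j) = 0 := by
      intro i j; simp [directSum, one_apply]
    have h5 : ∀ i j, (directSum m (1 : Matrix (Site M Ly) _ ℂ) - 1) (inB ℓ i) j = 0 := by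
      intro i
      rw [forall_site]
      simp [directSum, one_apply]
    ext (i | i) (j | j)
    · simp [mul_apply, sum_site, h3, h4, one_apply, -Matrix.sub_apply]
    · simp [mul_apply, sum_site, h3, h4, one_apply, -Matrix.sub_apply]
    · simp [mul_apply, h5, one_apply, -Matrix.sub_apply]
    · simp [mul_apply, h5, one_apply, -Matrix.sub_apply]
  rw [h2, det_fromBlocks_zero₂₁, det_one, mul_one]

/-- An operator that conserves the particle number. -/
def IsNumberConserving (ρ : Op Lx Ly) : Prop := ∀ s s', s.card ≠ s'.card → ρ s s' = 0

lemma isClosed_numberConserving : IsClosed {ρ : Op Lx Ly | IsNumberConserving ρ} := by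
  simp only [IsNumberConserving, Set.ofPred_forall]
  exact isClosed_iInter fun s => isClosed_iInter fun s' => isClosed_iInter fun _ =>
    isClosed_eq (continuous_id.matrix_elem s s') continuous_const

lemma isNumberConserving_secQuant (m : Matrix (Site Lx Ly) (Site Lx Ly) ℂ) :
    IsNumberConserving (secQuant m) := fun _ _ h => secQuant_apply_of_card_ne m h

lemma IsNumberConserving.mul {A B : Op Lx Ly} (hA : IsNumberConserving A)
    (hB : IsNumberConserving B) : IsNumberConserving (A * B) := by
  intro s s' h
  rw [mul_apply]
  refine Finset.sum_eq_zero fun r _ => ?_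
  by_cases hr : s.card = r.card
  · rw [hB r s' (hr ▸ h), mul_zero]
  · rw [hA s r hr, zero_mul]

lemma IsNumberConserving.traceB {ℓ M : ℕ} {ρ : Op (ℓ + M) Ly} (h : IsNumberConserving ρ) :
    IsNumberConserving (traceB ρ : Op ℓ Ly) := by
  intro s s' hs
  refine Finset.sum_eq_zero fun b _ => h _ _ ?_
  rw [card_joinConf, card_joinConf]
  omega

/-- The operators `Γ(m)` separate the number-conserving operators. -/
lemma IsNumberConserving.eq_zero {X : Op Lx Ly} (hX : IsNumberConserving X)
    (h : ∀ m, trace (secQuant m * X) = 0) : X = 0 := by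
  have key : ∀ k : ℕ, ∀ s s' : Finset (Site Lx Ly), s.card = k → s'.card = k → X s' s = 0 := by
    intro k
    induction k using Nat.strong_induction_on with
    | _ k ih =>
      intro s s' hs hs'
      let e := s.orderEmbOfFin hs
      let e' := s'.orderEmbOfFin hs'
      -- The order-preserving matching of `s` with `s'`. Its minor at `(s, s')` is `1`; other minors
      -- need `t ⊆ s` and `t' ⊆ s'`, so they meet entries of `X` already known to vanish by
      -- induction on the particle number.
      let m : Matrix (Site Lx Ly) (Site Lx Ly) ℂ :=
        Matrix.of fun i j => if ∃ a, e a = i ∧ e' a = j then 1 else 0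
      have hm : ∀ t t' : Finset (Site Lx Ly), t.card = t'.card → ¬(t = s ∧ t' = s') →
          secQuant m t t' * X t' t = 0 := by
        intro t t' hc hne
        by_cases hts : t ⊆ s
        · by_cases hts' : t' ⊆ s'
          · have hlt : t.card < k := by
              refine lt_of_le_of_ne (hs ▸ Finset.card_le_card hts) fun hk => hne ⟨?_, ?_⟩
              · exact Finset.eq_of_subset_of_card_le hts (by omega)
              · exact Finset.eq_of_subset_of_card_le hts' (by omega)
            rw [ih _ hlt t t' rfl hc.symm, mul_zero]
          · obtain ⟨j, hj, hjs⟩ := Finset.not_subset.mp hts'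
            have : j ∈ Set.range (t'.orderEmbOfFin hc.symm) := by simpa using hj
            obtain ⟨b, rfl⟩ := this
            rw [secQuant_apply m t t' rfl hc.symm, det_eq_zero_of_column_eq_zero b, zero_mul]
            intro a
            refine if_neg ?_
            rintro ⟨c, -, hc'⟩
            exact hjs (hc' ▸ Finset.orderEmbOfFin_mem _ _ _)
        · obtain ⟨j, hj, hjs⟩ := Finset.not_subset.mp hts
          have : j ∈ Set.range (t.orderEmbOfFin rfl) := by simpa using hj
          obtain ⟨b, rfl⟩ := this
          rw [secQuant_apply m t t' rfl hc.symm, det_eq_zero_of_row_eq_zero b, zero_mul]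
          intro a
          refine if_neg ?_
          rintro ⟨c, hc', -⟩
          exact hjs (hc' ▸ Finset.orderEmbOfFin_mem _ _ _)
      have h1 : secQuant m s s' = 1 := by
        rw [secQuant_apply m s s' hs hs']
        convert det_one (n := Fin k) (R := ℂ)
        ext a b
        simp only [submatrix_apply, m, of_apply, one_apply]
        refine if_congr ⟨?_, ?_⟩ rfl rfl
        · rintro ⟨c, hc, hc'⟩
          exact (e.injective hc).symm.trans (e'.injective hc')
        · rintro rfl
          exact ⟨a, rfl, rfl⟩
      have h2 := h m
      simp only [trace, diag_apply, mul_apply] at h2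
      rw [Finset.sum_eq_single s, Finset.sum_eq_single s', h1, one_mul] at h2
      · exact h2
      · intro t' _ ht'
        by_cases hc : s.card = t'.card
        · exact hm s t' hc fun h => ht' h.2
        · rw [secQuant_apply_of_card_ne m hc, zero_mul]
      · simp
      · intro t _ ht
        refine Finset.sum_eq_zero fun t' _ => ?_
        by_cases hc : t.card = t'.card
        · exact hm t t' hc fun h => ht h.1
        · rw [secQuant_apply_of_card_ne m hc, zero_mul]
      · simp
  ext s' s
  by_cases hc : s'.card = s.card
  · exact key _ s s' rfl hc
  · exact hX s' s hc

/-- A Gaussian number-conserving state is determined by its correlation matrix. -/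
lemma IsGaussianWith.state_unique {C : Matrix (Site Lx Ly) (Site Lx Ly) ℂ} {ρ ρ' : Op Lx Ly}
    (h : IsGaussianWith C ρ) (h' : IsGaussianWith C ρ') (hN : IsNumberConserving ρ)
    (hN' : IsNumberConserving ρ') : ρ = ρ' := by
  refine sub_eq_zero.mp (IsNumberConserving.eq_zero (fun s s' hs => ?_) fun m => ?_)
  · rw [Matrix.sub_apply, hN s s' hs, hN' s s' hs, sub_zero]
  · rw [mul_sub, trace_sub, h, h', sub_self]

/-- A number-conserving Gaussian state that is invariant under the `y`-translation is invariant
under the hopping in the `y` direction. -/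
lemma evolY_conj_eq_of_transY_conj_eq {ρ : Op Lx Ly} (h : IsGaussianWith (corrMatrix ρ) ρ)
    (hN : IsNumberConserving ρ) (hT : transY Lx Ly * ρ * (transY Lx Ly)⁻¹ = ρ) (t : ℝ) :
    evolY Lx Ly t * ρ * (evolY Lx Ly t)ᴴ = ρ := by
  have hC : Commute (corrMatrix ρ) (permOp (shiftY Lx Ly)) := by
    have h1 := h.conj (permOp_inv_mul (shiftY Lx Ly))
    rw [← transY_eq_secQuant, ← transY_inv_eq_secQuant, hT] at h1
    have h2 := congrArg (· * permOp (shiftY Lx Ly)) (h.unique h1)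
    simp only [mul_assoc, permOp_inv_mul, mul_one] at h2
    exact h2
  have hC' : Commute (corrMatrix ρ) (propagator (hop (shiftY Lx Ly)) t) :=
    ((Commute.hop_right hC).smul_right _).exp_right
  have hu : propagator (hop (shiftY Lx Ly)) (-t) * propagator (hop (shiftY Lx Ly)) t = 1 := by
    rw [← propagator_add, neg_add_cancel, propagator_zero]
  have hu' : propagator (hop (shiftY Lx Ly)) t * propagator (hop (shiftY Lx Ly)) (-t) = 1 := by
    rw [← propagator_add, add_neg_cancel, propagator_zero]
  have h3 := h.conj hu
  rw [← hC'.eq, mul_assoc, hu', mul_one] at h3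
  rw [evolY_conjTranspose]
  exact h3.state_unique h
    (((isNumberConserving_secQuant _).mul hN).mul (isNumberConserving_secQuant _)) hN

end Gaussian

/-! ### Gibbs states of mode occupations and their closure. -/

section GibbsStates

variable {Lx Ly : ℕ}

/-- The annihilation operator `∑ i, w i a_i`. -/
def annV (w : Site Lx Ly → ℂ) : Op Lx Ly := ∑ i, w i • ann i

lemma annV_conjTranspose_mul_self (w : Site Lx Ly → ℂ) :
    (annV w)ᴴ * annV w = quadOp (vecMulVec (star w) w) := by
  simp only [annV, conjTranspose_sum, conjTranspose_smul, Finset.sum_mul_sum, smul_mul_smul_comm]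
  rfl

lemma vecMulVec_star_isHermitian (w : Site Lx Ly → ℂ) : (vecMulVec (star w) w).IsHermitian := by
  rw [IsHermitian, conjTranspose_vecMulVec, star_star]

open scoped ComplexOrder in
lemma exp_posSemidef {ι : Type*} [Fintype ι] [DecidableEq ι] {h : Matrix ι ι ℂ}
    (hh : h.IsHermitian) : (NormedSpace.exp h).PosSemidef := by
  have h1 : ((1 / 2 : ℂ) • h).IsHermitian := by
    rw [IsHermitian, conjTranspose_smul, hh.eq]; simp
  have h2 : NormedSpace.exp h = (NormedSpace.exp ((1 / 2 : ℂ) • h))ᴴ *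
      NormedSpace.exp ((1 / 2 : ℂ) • h) := by
    rw [h1.exp.eq, ← Matrix.exp_add_of_commute _ _ (Commute.refl _), ← add_smul]
    norm_num
  rw [h2]
  exact posSemidef_conjTranspose_mul_self _

-- For Hermitian `h` the matrix `1 + exp h` is positive definite; this is the nonvanishing of the
-- partition function.
open scoped ComplexOrder in
lemma det_one_add_exp_ne_zero {ι : Type*} [Fintype ι] [DecidableEq ι] {h : Matrix ι ι ℂ}
    (hh : h.IsHermitian) : det (1 + NormedSpace.exp h) ≠ 0 :=
  (PosDef.one.add_posSemidef (exp_posSemidef hh)).det_pos.ne'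

variable {κ : Type*} [Fintype κ]

lemma gibbs_eq (w : κ → Site Lx Ly → ℂ) (lam : κ → ℝ) :
    gibbs (fun k => (annV (w k))ᴴ * annV (w k)) lam =
      (det (1 + NormedSpace.exp (-∑ k, (lam k : ℂ) • vecMulVec (star (w k)) (w k))))⁻¹ •
        secQuant (NormedSpace.exp (-∑ k, (lam k : ℂ) • vecMulVec (star (w k)) (w k))) := by
  have h : (-∑ k, (lam k : ℂ) • ((annV (w k))ᴴ * annV (w k))) =
      quadOp (-∑ k, (lam k : ℂ) • vecMulVec (star (w k)) (w k)) := by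
    rw [← neg_one_smul ℂ (∑ k, (lam k : ℂ) • vecMulVec (star (w k)) (w k)), quadOp_smul,
      quadOp_sum, neg_one_smul]
    simp only [quadOp_smul, annV_conjTranspose_mul_self]
  rw [gibbs, h, exp_quadOp, trace_secQuant]

lemma isHermitian_neg_sum_smul_vecMulVec (w : κ → Site Lx Ly → ℂ) (lam : κ → ℝ) :
    (-∑ k, (lam k : ℂ) • vecMulVec (star (w k)) (w k)).IsHermitian := by
  rw [IsHermitian, conjTranspose_neg, conjTranspose_sum]
  simp only [conjTranspose_smul, (vecMulVec_star_isHermitian _).eq]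
  simp

lemma gibbs_isGaussian (w : κ → Site Lx Ly → ℂ) (lam : κ → ℝ) :
    IsGaussianWith (corrMatrix (gibbs (fun k => (annV (w k))ᴴ * annV (w k)) lam))
      (gibbs (fun k => (annV (w k))ᴴ * annV (w k)) lam) := by
  suffices h : ∃ C, IsGaussianWith C (gibbs (fun k => (annV (w k))ᴴ * annV (w k)) lam) by
    obtain ⟨C, hC⟩ := h
    rwa [hC.corrMatrix_eq]
  have hd := det_one_add_exp_ne_zero (isHermitian_neg_sum_smul_vecMulVec w lam)
  rw [gibbs_eq]
  set g := NormedSpace.exp (-∑ k, (lam k : ℂ) • vecMulVec (star (w k)) (w k))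
  -- The Fermi–Dirac matrix: `tr (Γ(m) Γ(g)) / tr Γ(g)` is `det (1 + m g) / det (1 + g)`.
  refine ⟨g * (1 + g)⁻¹, fun m => ?_⟩
  have hi : (1 + g) * (1 + g)⁻¹ = 1 := mul_nonsing_inv _ hd.isUnit
  have h1 : 1 + (m - 1) * (g * (1 + g)⁻¹) = (1 + m * g) * (1 + g)⁻¹ := by
    calc 1 + (m - 1) * (g * (1 + g)⁻¹) = (1 + g) * (1 + g)⁻¹ + (m - 1) * (g * (1 + g)⁻¹) := by
          rw [hi]
      _ = _ := by noncomm_ring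
  rw [mul_smul_comm, trace_smul, ← secQuant_mul, trace_secQuant, h1, det_mul, det_nonsing_inv,
    Ring.inverse_eq_inv', smul_eq_mul, mul_comm]

lemma gibbs_isNumberConserving (w : κ → Site Lx Ly → ℂ) (lam : κ → ℝ) :
    IsNumberConserving (gibbs (fun k => (annV (w k))ᴴ * annV (w k)) lam) := by
  intro s s' h
  rw [gibbs_eq, Matrix.smul_apply, secQuant_apply_of_card_ne _ h, smul_zero]

lemma closure_gibbs_subset (w : κ → Site Lx Ly → ℂ) {S : Set (Op Lx Ly)} (hS : IsClosed S)
    (h : ∀ lam, gibbs (fun k => (annV (w k))ᴴ * annV (w k)) lam ∈ S) :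
    closure (Set.range (gibbs fun k => (annV (w k))ᴴ * annV (w k))) ⊆ S :=
  closure_minimal (Set.range_subset_iff.mpr h) hS

lemma alphaMode_eq_annV (U : Fin Lx → Matrix.unitaryGroup (Fin Ly) ℂ) (p : Fin Lx × Fin Ly) :
    alphaMode U p = annV fun i => (U p.1 : Matrix (Fin Ly) (Fin Ly) ℂ) p.2 (ofLex i).2 *
      ((Real.sqrt (Lx : ℝ) : ℂ))⁻¹ * phase p.1 (ofLex i).1 := by
  rw [alphaMode, annV, sum_site_prod, Finset.sum_comm]
  simp only [xMode, Finset.smul_sum, smul_smul, ofLex_toLex]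
  refine Finset.sum_congr rfl fun y _ => Finset.sum_congr rfl fun x _ => ?_
  rw [mul_assoc]

lemma momMode_eq_annV (q : Fin Lx × Fin Ly) :
    momMode q = annV fun i => ((Real.sqrt ((Lx : ℝ) * (Ly : ℝ)) : ℂ))⁻¹ *
      (phase q.1 (ofLex i).1 * phase q.2 (ofLex i).2) := by
  rw [momMode, annV, sum_site_prod]
  simp only [Finset.smul_sum, smul_smul, ofLex_toLex]

lemma phase_finRotate {L : ℕ} (k x : Fin L) :
    phase k (finRotate L x) =
      Complex.exp (-(Complex.I * (2 * Real.pi * (k : ℕ) / (L : ℕ)))) * phase k x := by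
  obtain _ | n := L
  · exact k.elim0
  rw [phase, phase, ← Complex.exp_add]
  have hn : ((n : ℂ) + 1) ≠ 0 := Nat.cast_add_one_ne_zero n
  by_cases hx : x = Fin.last n
  · subst hx
    rw [finRotate_last]
    simp only [Fin.val_zero, Fin.val_last]
    -- Wrapping around from the last site to `0` changes the exponent by `k` full turns.
    refine Complex.exp_eq_exp_iff_exists_int.mpr ⟨(k : ℕ), ?_⟩
    push_cast
    field_simp
    ring
  · rw [coe_finRotate_of_ne_last hx]
    congr 1
    push_cast
    field_simp
    ring

/-- The occupations of the Fourier modes are invariant under the `y`-translation. -/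
lemma commute_permOp_shiftY_momMode (q : Fin Lx × Fin Ly) (c : ℂ) :
    Commute (permOp (shiftY Lx Ly))
      (vecMulVec (star fun i : Site Lx Ly => c * (phase q.1 (ofLex i).1 * phase q.2 (ofLex i).2))
        fun i => c * (phase q.1 (ofLex i).1 * phase q.2 (ofLex i).2)) := by
  refine commute_permOp fun i j => ?_
  have hz : star (Complex.exp (-(Complex.I * (2 * Real.pi * (q.2 : ℕ) / (Ly : ℕ))))) *
      Complex.exp (-(Complex.I * (2 * Real.pi * (q.2 : ℕ) / (Ly : ℕ)))) = 1 := by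
    rw [Complex.star_def, ← Complex.exp_conj, ← Complex.exp_add]
    simp [Complex.conj_ofNat]
  simp only [vecMulVec_apply, Pi.star_apply, shiftY_apply, ofLex_toLex, phase_finRotate, star_mul']
  linear_combination (star c * (star (phase q.1 (ofLex i).1) * star (phase q.2 (ofLex i).2)) *
    (c * (phase q.1 (ofLex j).1 * phase q.2 (ofLex j).2))) * hz

/-- The generalized Gibbs ensembles of `H` are invariant under the `y`-translation. -/
lemma IsGGE.commute_secQuant_shiftY {ψ : FockVec Lx Ly} {ρ : Op Lx Ly} (h : IsGGE charge ψ ρ) :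
    Commute (secQuant (permOp (shiftY Lx Ly))) ρ := by
  have hcl : IsClosed {ρ : Op Lx Ly | Commute (secQuant (permOp (shiftY Lx Ly))) ρ} :=
    isClosed_eq (continuous_const.matrix_mul continuous_id)
      (continuous_id.matrix_mul continuous_const)
  have hch : (charge : Fin Lx × Fin Ly → Op Lx Ly) = fun q =>
      (annV fun i => ((Real.sqrt ((Lx : ℝ) * (Ly : ℝ)) : ℂ))⁻¹ *
        (phase q.1 (ofLex i).1 * phase q.2 (ofLex i).2))ᴴ *
      annV fun i => ((Real.sqrt ((Lx : ℝ) * (Ly : ℝ)) : ℂ))⁻¹ *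
        (phase q.1 (ofLex i).1 * phase q.2 (ofLex i).2) := by
    ext1 q
    rw [charge, momMode_eq_annV]
  have h1 := h.1
  rw [hch] at h1
  refine closure_gibbs_subset _ hcl (fun lam => ?_) h1
  rw [Set.mem_ofPred_eq, gibbs_eq]
  refine Commute.smul_right ?_ _
  have : Commute (permOp (shiftY Lx Ly)) (NormedSpace.exp (-∑ q : Fin Lx × Fin Ly, (lam q : ℂ) •
      vecMulVec (star fun i : Site Lx Ly => ((Real.sqrt ((Lx : ℝ) * (Ly : ℝ)) : ℂ))⁻¹ *
        (phase q.1 (ofLex i).1 * phase q.2 (ofLex i).2))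
      fun i => ((Real.sqrt ((Lx : ℝ) * (Ly : ℝ)) : ℂ))⁻¹ *
        (phase q.1 (ofLex i).1 * phase q.2 (ofLex i).2))) :=
    (Commute.sum_right _ _ _ fun q _ =>
      (commute_permOp_shiftY_momMode q _).smul_right _).neg_right.exp_right
  rw [Commute, SemiconjBy, ← secQuant_mul, this.eq, secQuant_mul]

/-- The generalized Gibbs ensembles of `H^X` are Gaussian and conserve the particle number. -/
lemma IsGGE.gaussian {U : Fin Lx → Matrix.unitaryGroup (Fin Ly) ℂ} {ψ : FockVec Lx Ly}
    {ρ : Op Lx Ly} (h : IsGGE (chargeX U) ψ ρ) :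
    IsGaussianWith (corrMatrix ρ) ρ ∧ IsNumberConserving ρ := by
  have hch : chargeX U = fun p => (annV fun i : Site Lx Ly =>
        (U p.1 : Matrix (Fin Ly) (Fin Ly) ℂ) p.2 (ofLex i).2 *
          ((Real.sqrt (Lx : ℝ) : ℂ))⁻¹ * phase p.1 (ofLex i).1)ᴴ *
      annV fun i => (U p.1 : Matrix (Fin Ly) (Fin Ly) ℂ) p.2 (ofLex i).2 *
        ((Real.sqrt (Lx : ℝ) : ℂ))⁻¹ * phase p.1 (ofLex i).1 := by
    ext1 p
    rw [chargeX, alphaMode_eq_annV]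
  have h1 := h.1
  rw [hch] at h1
  exact ⟨closure_gibbs_subset _ isClosed_gaussian (gibbs_isGaussian _) h1,
    closure_gibbs_subset _ isClosed_numberConserving (gibbs_isNumberConserving _) h1⟩

end GibbsStates

/-! ### Reduced states in the limit of sizes and of times. -/

section ReducedStates

variable {ℓ Ly : ℕ} {𝓛 : Filter ℕ} {ψ : ∀ M : ℕ, FockVec (ℓ + M) Ly} {R : Op ℓ Ly}

lemma IsReducedGGEX.gaussian [𝓛.NeBot] (h : IsReducedGGEX 𝓛 ψ R) :
    IsGaussianWith (corrMatrix R) R ∧ IsNumberConserving R := by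
  obtain ⟨U, ρ, hρ, hlim⟩ := h
  constructor
  · refine isClosed_gaussian.mem_of_tendsto hlim (Eventually.of_forall fun M => ?_)
    have := (hρ M).gaussian.1.traceB
    rwa [← this.corrMatrix_eq] at this
  · exact isClosed_numberConserving.mem_of_tendsto hlim
      (Eventually.of_forall fun M => (hρ M).gaussian.2.traceB)

lemma IsReducedGGE.transY_conj [𝓛.NeBot] (h : IsReducedGGE 𝓛 ψ R) :
    transY ℓ Ly * R * (transY ℓ Ly)⁻¹ = R := by
  obtain ⟨ρ, hρ, hlim⟩ := h
  have hcl : IsClosed {X : Op ℓ Ly | transY ℓ Ly * X * (transY ℓ Ly)⁻¹ = X} :=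
    isClosed_eq ((continuous_const.matrix_mul continuous_id).matrix_mul continuous_const)
      continuous_id
  refine hcl.mem_of_tendsto hlim (Eventually.of_forall fun M => ?_)
  rw [Set.mem_ofPred_eq, transY_inv_eq_secQuant, transY_eq_secQuant,
    ← traceB_opProd_mul_mul _ _ (Y := secQuant (permOp (shiftY M Ly)))
      (Y' := secQuant (permOp (shiftY M Ly)⁻¹)), ← secQuant_directSum, ← secQuant_directSum,
    ← permOp_shiftY_eq_directSum, ← permOp_shiftY_inv_eq_directSum,
    (hρ M).commute_secQuant_shiftY.eq, mul_assoc, ← secQuant_mul, permOp_mul_inv, secQuant_one,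
    mul_one]
  rw [← secQuant_mul, permOp_inv_mul, secQuant_one]

lemma reducedEvolution_ham_eq [𝓛.NeBot] {ρA ρXA : ℝ → Op ℓ Ly}
    (hρA : IsReducedEvolution 𝓛 (fun M => ham (ℓ + M) Ly) ψ ρA)
    (hρXA : IsReducedEvolution 𝓛 (fun M => hamX (ℓ + M) Ly) ψ ρXA) {t : ℝ} (ht : 0 ≤ t) :
    ρA t = evolY ℓ Ly t * ρXA t * (evolY ℓ Ly t)ᴴ := by
  refine tendsto_nhds_unique (hρA t ht) ?_
  simp only [traceB_evolve_ham]
  exact (tendsto_const_nhds.mul (hρXA t ht)).mul tendsto_const_nhds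

/-- If `ρ_A(t)` converges, its limit is that of `ρ_{X,A}(t)`. -/
lemma limit_eq {X : ℝ → Op ℓ Ly} {R' : Op ℓ Ly} (hR : Tendsto X atTop (𝓝 R))
    (hR' : Tendsto (fun t => evolY ℓ Ly t * X t * (evolY ℓ Ly t)ᴴ) atTop (𝓝 R')) : R' = R := by
  have h1 : Tendsto (fun t => evolY ℓ Ly t * (X t - R) * (evolY ℓ Ly t)ᴴ) atTop (𝓝 0) :=
    tendsto_conj_zero evolY_conjTranspose_mul_self evolY_mul_conjTranspose_self
      (by simpa using hR.sub_const R)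
  have h2 : Tendsto (fun t => evolY ℓ Ly t * R * (evolY ℓ Ly t)ᴴ) atTop (𝓝 R') := by
    have := hR'.sub h1
    rw [sub_zero] at this
    refine this.congr fun t => ?_
    rw [← sub_mul, ← mul_sub, sub_sub_cancel]
  -- Conjugating by `V(s)` only shifts the time in `h2`, which leaves the limit unchanged.
  have h3 : ∀ s, evolY ℓ Ly s * R' * (evolY ℓ Ly s)ᴴ = R' := by
    intro s
    have h4 : Tendsto (fun t => evolY ℓ Ly s * (evolY ℓ Ly t * R * (evolY ℓ Ly t)ᴴ) *
        (evolY ℓ Ly s)ᴴ) atTop (𝓝 (evolY ℓ Ly s * R' * (evolY ℓ Ly s)ᴴ)) :=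
      (tendsto_const_nhds.mul h2).mul tendsto_const_nhds
    refine tendsto_nhds_unique h4 ((h2.comp (tendsto_atTop_add_const_left _ s tendsto_id)).congr
      fun t => ?_)
    simp only [Function.comp, id, evolY_add, conjTranspose_mul, mul_assoc]
  -- Undoing the evolution preserves the norm of the error, and as `R'` is invariant the result is
  -- the constant `R - R'`.
  have h5 : Tendsto (fun t => evolY ℓ Ly (-t) * (evolY ℓ Ly t * R * (evolY ℓ Ly t)ᴴ - R') *
      (evolY ℓ Ly (-t))ᴴ) atTop (𝓝 0) :=
    tendsto_conj_zero (fun _ => evolY_conjTranspose_mul_self _)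
      (fun _ => evolY_mul_conjTranspose_self _) (by simpa using h2.sub_const R')
  have h6 : ∀ t, evolY ℓ Ly (-t) * (evolY ℓ Ly t * R * (evolY ℓ Ly t)ᴴ - R') *
      (evolY ℓ Ly (-t))ᴴ = R - R' := by
    intro t
    have h7 : evolY ℓ Ly (-t) * evolY ℓ Ly t = 1 := by
      rw [← evolY_add, neg_add_cancel, evolY_zero]
    rw [mul_sub, sub_mul, h3, evolY_conjTranspose, evolY_conjTranspose, neg_neg, ← mul_assoc,
      ← mul_assoc, h7, one_mul, mul_assoc, h7, mul_one]
  simp only [h6] at h5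
  exact (sub_eq_zero.mp (tendsto_nhds_unique tendsto_const_nhds h5)).symm

end ReducedStates

end FermionQuench

end

/-! ### The equivalence. -/

open FermionQuench in
/-- The filter `𝓛` describes how the number `M = Lx - ℓ` of columns outside the strip is treated
before the time limit: `atTop` is the thermodynamic limit in the `x` direction, `pure M` is a fixed
finite system. -/
theorem mainTheorem2 (ℓ Ly : ℕ) (𝓛 : Filter ℕ) (h𝓛 : 𝓛.NeBot)
    (ψ : ∀ M : ℕ, FockVec (ℓ + M) Ly) (hψ : ∀ M, star (ψ M) ⬝ᵥ ψ M = 1)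
    (ρA ρXA : ℝ → Op ℓ Ly)
    (hρA : IsReducedEvolution 𝓛 (fun M => ham (ℓ + M) Ly) ψ ρA)
    (hρXA : IsReducedEvolution 𝓛 (fun M => hamX (ℓ + M) Ly) ψ ρXA)
    (R : Op ℓ Ly)
    (hR : Tendsto ρXA atTop (𝓝 R)) (hRX : IsReducedGGEX 𝓛 ψ R)
    (hA : ∀ R' : Op ℓ Ly, Tendsto ρA atTop (𝓝 R') → IsReducedGGE 𝓛 ψ R') :
    ((∃ R' : Op ℓ Ly, Tendsto ρA atTop (𝓝 R')) ↔
        transY ℓ Ly * R * (transY ℓ Ly)⁻¹ = R) ∧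
      ((∃ R' : Op ℓ Ly, Tendsto ρA atTop (𝓝 R')) ↔ IsReducedGGE 𝓛 ψ R) := by
  have heq : ρA =ᶠ[atTop] fun t => evolY ℓ Ly t * ρXA t * (evolY ℓ Ly t)ᴴ := by
    filter_upwards [eventually_ge_atTop (0 : ℝ)] with t ht
    exact reducedEvolution_ham_eq hρA hρXA ht
  have h13 : (∃ R' : Op ℓ Ly, Tendsto ρA atTop (𝓝 R')) → IsReducedGGE 𝓛 ψ R := by
    rintro ⟨R', hR'⟩
    rw [← limit_eq hR (hR'.congr' heq)]
    exact hA R' hR'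
  have h21 : transY ℓ Ly * R * (transY ℓ Ly)⁻¹ = R →
      ∃ R' : Op ℓ Ly, Tendsto ρA atTop (𝓝 R') := by
    intro hT
    refine ⟨R, Tendsto.congr' heq.symm ?_⟩
    -- As `V(t)` fixes `R`, the difference `ρ_A(t) - R` is the conjugate of `ρ_{X,A}(t) - R`.
    have h1 : Tendsto (fun t => evolY ℓ Ly t * (ρXA t - R) * (evolY ℓ Ly t)ᴴ) atTop (𝓝 0) :=
      tendsto_conj_zero evolY_conjTranspose_mul_self evolY_mul_conjTranspose_self
        (by simpa using hR.sub_const R)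
    have h2 := h1.add_const R
    rw [zero_add] at h2
    refine h2.congr fun t => ?_
    rw [mul_sub, sub_mul, evolY_conj_eq_of_transY_conj_eq hRX.gaussian.1 hRX.gaussian.2 hT,
      sub_add_cancel]
  exact ⟨⟨fun h => (h13 h).transY_conj, h21⟩, ⟨h13, fun h => h21 h.transY_conj⟩⟩
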